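/- Let $A$ be a finite alphabet. A *word* is a finite sequence of letters of $A$, $|w|$ is its length, and a *sentence* $I=(w_1,\dots,w_k)$ is a finite sequence of nonempty words, with $\ell(I)=k$, $w(I)=w_1\cdots w_k$, $w\ell(I)=(|w_1|,\dots,|w_k|)$ and $I^r=(w_k,\dots,w_1)$. Write $Q\preceq S$ if $S$ is obtained from $Q$ by concatenating some adjacent words. Let $NSym_A$ be the free associative $\mathbb{Q}$-algebra on generators $H_w$, one for each nonempty word $w$, with linear basis $H_I=H_{w_1}\cdots H_{w_k}$, and put $H_\emptyset=1$. Let $x_{a,i}$ ($a\in A$, $i\ge 1$) be variables such that variables with different second indices commute and variables with the same second index satisfy no relations; for $w=a_1\cdots a_n$ put $x_{w,i}=x_{a_1,i}\cdots x_{a_n,i}$. Let $QSym_A$ be the space of formal power series spanned over $\mathbb{Q}$ by $M_I=\sum_{1\le j_1<\dots<j_k}x_{w_1,j_1}\cdots x_{w_k,j_k}$, paired with $NSym_A$ by the bilinear form $\langle H_I,M_J\rangle=\delta_{I,J}$. For $M\in QSym_A$ let $M^{\perp_r}$ be the operator on $NSym_A$ given by $M^{\perp_r}(f)=\sum_I\langle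 f,M_I M\rangle H_I$, that is, $\langle M^{\perp_r}f,G\rangle=\langle f,GM\rangle$ for all $G\in QSym_A$. For a word $v$ put $$\mathbb{B}_v=\sum_{Q}(-1)^{\ell(Q)}H_{v\cdot w(Q^r)}\Big(\sum_{S\succeq Q}M_S^{\perp_r}\Big),$$ the first sum being over all sentences $Q$ (only finitely many terms act nontrivially on a given element). The *colored immaculate function* of a sentence $J=(v_1,\dots,v_h)$ is $\mathfrak{S}_J=\mathbb{B}_{v_1}\cdots\mathbb{B}_{v_h}(1)\in NSym_A$. The *colored dual immaculate function* is $\mathfrak{S}^*_J=\sum_T x_T$, summed over all fillings $T$ with positive integers of the diagram whose $i$-th row has $|v_i|$ boxes colored by the successive letters of $v_i$, with rows weakly increasing from left to right and first column strictly increasing from top to bottom; here $x_T=x_{u_1,1}x_{u_2,2}\cdots$, where $u_k$ is the word of the colors of the boxes with entry $k$, the rows being read from bottom to top and each row from left to right. **(1)** $\{\mathfrak{S}_J\}_J$ is a basis of $NSym_A$, $\{\mathfrak{S}^*_J\}_J$ is a basis of $QSym_A$, and these bases are dual: $\langle\mathfrak{S}_I,\mathfrak{S}^*_J\rangle=\delta_{I,J}$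 for all sentences $I,J$. **(2)** Let $NSym=\mathbb{Q}\langle H_1,H_2,\dots\rangle$ with basis $H_\alpha=H_{\alpha_1}\cdots H_{\alpha_k}$ indexed by compositions, let $H_0=1$ and $H_m=0$ for $m<0$, and let $NSym$ be paired with the algebra $QSym$ of quasisymmetric functions by $\langle H_\alpha,M_\beta\rangle=\delta_{\alpha,\beta}$, where $M_\beta$ is the monomial quasisymmetric function. For $F\in QSym$ let $F^\perp(f)=\sum_\alpha\langle f,FM_\alpha\rangle H_\alpha$, let $F_{1^i}$ be the fundamental quasisymmetric function indexed by $(1,\dots,1)$ ($i$ ones), and for $m\in\mathbb{Z}$ put $\mathbb{B}_m=\sum_{i\ge0}(-1)^iH_{m+i}F_{1^i}^\perp$; the *immaculate function* is $\mathfrak{S}_\alpha=\mathbb{B}_{\alpha_1}\cdots\mathbb{B}_{\alpha_m}(1)$. Let $\upsilon:NSym_A\to NSym$ be the linear map with $\upsilon(H_I)=H_{w\ell(I)}$. If $A$ has exactly one letter, then $\upsilon(\mathfrak{S}_I)=\mathfrak{S}_{w\ell(I)}$ for every sentence $I$. -/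

import Mathlib

noncomputable section

namespace ColoredImmaculate

/-! Formal power series with rational coefficients, given by their coefficient functions, and
monomials in variables indexed by `ℕ` (the index `i` stands for the variable index `i + 1`). -/

/-- The coefficient function of the formal sum `∑ i, mon i` of monomials: the coefficient of `m` is
the number of indices `i` whose monomial is `m`. -/
def formalSum {ι M : Type*} (mon : ι → M) : M → ℚ :=
  fun m => (Nat.card {i : ι // mon i = m} : ℚ)

/-- The monomial `x_{w 0, j 0} x_{w 1, j 1} ⋯`. -/
def placeAt {W : Type*} [AddMonoid W] {k : ℕ} (w : Fin k → W) (j : Fin k → ℕ) : ℕ →₀ W :=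
  (List.ofFn fun i => Finsupp.single (j i) (w i)).sum

/-! Words and sentences over an alphabet `A`. -/

/-- Words over `A`. -/
abbrev Word (A : Type*) := List A

/-- Nonempty words over `A`. -/
abbrev NWord (A : Type*) := {w : Word A // w ≠ []}

/-- Sentences: finite sequences of nonempty words. -/
abbrev Sentence (A : Type*) := List (NWord A)

/-- Compositions: finite sequences of positive integers. -/
abbrev Comp := List ℕ+

/-- The set of partial sums `α₁, α₁ + α₂, …, α₁ + ⋯ + α_k` of a composition. -/
def partialSums (α : Comp) : Set ℕ :=
  {s | ∃ k, 1 ≤ k ∧ k ≤ α.length ∧ s = ((α.take k).map PNat.val).sum}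

/-- The refinement order `α ⪯ β` on compositions. -/
def Comp.Refines (α β : Comp) : Prop :=
  (α.map PNat.val).sum = (β.map PNat.val).sum ∧ partialSums β ⊆ partialSums α

section Alphabet

variable {A : Type*}

/-- The maximal word `w(I)`, the concatenation of all words of `I`. -/
def maxWord (I : Sentence A) : Word A := (I.map Subtype.val).flatten

/-- The word lengths `wℓ(I)` of a sentence. -/
def wordLengths (I : Sentence A) : Comp :=
  I.map fun w => ⟨w.1.length, List.length_pos_iff.2 w.2⟩

/-- The refinement order `I ⪯ J` on sentences: `J` is a coarsening of `I`. -/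
def Sentence.Refines (I J : Sentence A) : Prop :=
  maxWord I = maxWord J ∧ Comp.Refines (wordLengths I) (wordLengths J)

end Alphabet

/-! Colored noncommutative symmetric functions. -/

/-- `NSym_A`, the algebra freely generated by `H_w` for nonempty words `w`, realized as the algebra
of the free monoid of sentences. -/
abbrev NSymA (A : Type*) := MonoidAlgebra ℚ (FreeMonoid (NWord A))

/-- The complete homogeneous basis element `H_I`. -/
def H {A : Type*} (I : Sentence A) : NSymA A := MonoidAlgebra.of ℚ _ (FreeMonoid.ofList I)

open Classical in
/-- `H_w` for a possibly empty word `w`, with `H_∅ = 1`. -/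
def Hword {A : Type*} (w : Word A) : NSymA A := if h : w = [] then 1 else H [⟨w, h⟩]

/-! Partially commutative power series and colored quasisymmetric functions. -/

/-- Monomials in the partially commutative variables `x_{a,i}`: two variables commute if and only if
their second indices differ or they are equal, so that a monomial is a finitely supported family of
words, the `i`-th of which is the product of the variables with second index `i`. -/
abbrev ColMonomial (A : Type*) := ℕ →₀ FreeAddMonoid A

/-- Formal power series over `ℚ` in the partially commutative variables `x_{a,i}`. -/
def ColSeries (A : Type*) := ColMonomial A → ℚ

instance (A : Type*) : AddCommGroup (ColSeries A) := inferInstanceAs (AddCommGroup (_ → ℚ))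

instance (A : Type*) : Module ℚ (ColSeries A) := inferInstanceAs (Module ℚ (_ → ℚ))

/-- The product of formal power series; every monomial has only finitely many factorizations. -/
instance (A : Type*) : Mul (ColSeries A) :=
  ⟨fun F G m => ∑ᶠ p : {p : ColMonomial A × ColMonomial A // p.1 + p.2 = m}, F p.1.1 * G p.1.2⟩

/-- The coefficient of a monomial in a power series. -/
def ColSeries.coeff {A : Type*} (m : ColMonomial A) : ColSeries A →ₗ[ℚ] ℚ where
  toFun F := F m
  map_add' _ _ := rfl
  map_smul' _ _ := rfl

section Colored

variable {A : Type*}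

/-- The words of a sentence as elements of the free monoid on `A`. -/
def wordAt (I : Sentence A) (i : Fin I.length) : FreeAddMonoid A :=
  FreeAddMonoid.ofList (I.get i).1

/-- The colored monomial quasisymmetric function
`M_I = ∑_{j₁ < ⋯ < j_k} x_{w₁,j₁} ⋯ x_{w_k,j_k}`. -/
def M (I : Sentence A) : ColSeries A :=
  formalSum fun j : Fin I.length ↪o ℕ => placeAt (wordAt I) j

variable (A) in
/-- `QSym_A`, the span of the colored monomial quasisymmetric functions. -/
def QSymA : Submodule ℚ (ColSeries A) := Submodule.span ℚ (Set.range (M (A := A)))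

/-- The monomial `x_{w₁,1} ⋯ x_{w_k,k}` of a sentence `(w₁, …, w_k)`. -/
def stdMonomial (I : Sentence A) : ColMonomial A := placeAt (wordAt I) fun i => (i : ℕ)

/-- The bilinear pairing of `NSym_A` and `QSym_A`: the pairing of `H_I` with `F` is the coefficient
in `F` of the monomials with sentence `I`. By `pairing_H_M` it is the one with
`⟨H_I, M_J⟩ = δ_{I,J}`. -/
def pairing : NSymA A →ₗ[ℚ] ColSeries A →ₗ[ℚ] ℚ :=
  (Finsupp.linearCombination ℚ fun I : FreeMonoid (NWord A) =>
    ColSeries.coeff (stdMonomial (FreeMonoid.toList I))) ∘ₗ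
  (MonoidAlgebra.coeffLinearEquiv ℚ : NSymA A ≃ₗ[ℚ] _).toLinearMap

/-- The right perp operator `F^⫫`, adjoint to right multiplication by `F`:
`F^⫫(f) = ∑_I ⟨f, M_I F⟩ H_I`. Only finitely many terms are nonzero. -/
def rperp (F : ColSeries A) (f : NSymA A) : NSymA A :=
  ∑ᶠ I : Sentence A, pairing f (M I * F) • H I

/-- The colored noncommutative Bernstein operator `𝔹_v`, the sum over all sentences
`Q = (q₁, …, q_i)` (with `u = q_i ⋯ q₁ = w(Q^r)`) of `(-1)^i H_{v u} ∑_{Q ⪯ S} M_S^⫫`. On each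
element of `NSym_A` only finitely many terms are nonzero. -/
def bernsteinA (v : Word A) (f : NSymA A) : NSymA A :=
  ∑ᶠ Q : Sentence A, (-1 : ℚ) ^ Q.length •
    (Hword (v ++ maxWord Q.reverse) *
      ∑ᶠ (S : Sentence A) (_ : Sentence.Refines Q S), rperp (M S) f)

/-- The colored immaculate function `𝔖_J = 𝔹_{v₁} ⋯ 𝔹_{v_h}(1)`. -/
def immaculateA (J : Sentence A) : NSymA A := J.foldr (fun v f => bernsteinA v.1 f) 1

/-- Colored immaculate tableaux of shape `J`: the box in row `i` and column `j` has the color of the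
`j`-th letter of the `i`-th word of `J`; its entry is `entry i j` (standing for the positive integer
`entry i j + 1`). -/
structure CIT (J : Sentence A) where
  entry : (i : Fin J.length) → Fin (J.get i).1.length → ℕ
  row_weak : ∀ i, Monotone (entry i)
  col_strict : ∀ i i', i < i' →
    entry i ⟨0, List.length_pos_iff.2 (J.get i).2⟩ <
      entry i' ⟨0, List.length_pos_iff.2 (J.get i').2⟩

namespace CIT

variable {J : Sentence A}

/-- The `k`-th word of the type of `T`: the colors of the boxes with entry `k`, rows read from
bottom to top and each row from left to right. -/
def typeWord (T : CIT J) (k : ℕ) : Word A :=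
  (List.finRange J.length).reverse.flatMap fun i =>
    ((List.finRange (J.get i).1.length).filter fun j => T.entry i j = k).map fun j =>
      (J.get i).1.get j

theorem typeWord_finite (T : CIT J) :
    (Function.support fun k => FreeAddMonoid.ofList (T.typeWord k)).Finite := by
  refine (Set.finite_range fun b : (Σ i : Fin J.length, Fin (J.get i).1.length) =>
    T.entry b.1 b.2).subset ?_
  intro k hk
  by_contra hne
  apply hk
  have : T.typeWord k = [] := by
    simp only [typeWord, List.flatMap_eq_nil_iff, List.map_eq_nil_iff, List.filter_eq_nil_iff]
    intro i _ j _ h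
    exact hne ⟨⟨i, j⟩, by simpa using h⟩
  simp [this]

/-- The monomial `x_T = x_{u₁,1} x_{u₂,2} ⋯` of a tableau of type `(u₁, u₂, …)`. -/
def monomial (T : CIT J) : ColMonomial A :=
  Finsupp.ofSupportFinite (fun k => FreeAddMonoid.ofList (T.typeWord k)) T.typeWord_finite

end CIT

/-- The colored dual immaculate function `𝔖*_J = ∑_T x_T`. -/
def dualImmaculateA (J : Sentence A) : ColSeries A := formalSum fun T : CIT J => T.monomial

end Colored

/-! The uncolored case. -/

/-- `NSym`, the free algebra on `H₁, H₂, …`, with basis indexed by compositions. -/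
abbrev NSym := MonoidAlgebra ℚ (FreeMonoid ℕ+)

/-- The complete homogeneous basis element `H_α`. -/
def Hcomp (α : Comp) : NSym := MonoidAlgebra.of ℚ _ (FreeMonoid.ofList α)

/-- `H_m` for an integer `m`, with `H_0 = 1` and `H_m = 0` for `m < 0`. -/
def Hint (m : ℤ) : NSym :=
  if h : 0 < m then Hcomp [⟨m.toNat, by omega⟩] else if m = 0 then 1 else 0

/-- The monomial quasisymmetric function `M_α`. -/
def Mcomp (α : Comp) : MvPowerSeries ℕ ℚ :=
  formalSum fun j : Fin α.length ↪o ℕ => placeAt (fun i => (α.get i : ℕ)) j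

/-- The fundamental quasisymmetric function `F_α`, the sum of `M_β` over the refinements of `α`. -/
def Fcomp (α : Comp) : MvPowerSeries ℕ ℚ := ∑ᶠ (β : Comp) (_ : Comp.Refines β α), Mcomp β

/-- The monomial `x₁^{α₁} ⋯ x_k^{α_k}`. -/
def stdExponent (α : Comp) : ℕ →₀ ℕ := placeAt (fun i => (α.get i : ℕ)) fun i => (i : ℕ)

/-- The bilinear pairing of `NSym` and `QSym` with `⟨H_α, M_β⟩ = δ_{α,β}`: the pairing of `H_α` with
`F` is the coefficient of `x₁^{α₁} ⋯ x_k^{α_k}` in `F`. -/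
def pairingU : NSym →ₗ[ℚ] MvPowerSeries ℕ ℚ →ₗ[ℚ] ℚ :=
  (Finsupp.linearCombination ℚ fun α : FreeMonoid ℕ+ =>
    (MvPowerSeries.coeff (stdExponent (FreeMonoid.toList α)) : MvPowerSeries ℕ ℚ →ₗ[ℚ] ℚ)) ∘ₗ
  (MonoidAlgebra.coeffLinearEquiv ℚ : NSym ≃ₗ[ℚ] _).toLinearMap

/-- The perp operator `F^⊥(f) = ∑_α ⟨f, F M_α⟩ H_α`. Only finitely many terms are nonzero. -/
def perpU (F : MvPowerSeries ℕ ℚ) (f : NSym) : NSym :=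
  ∑ᶠ α : Comp, pairingU f (F * Mcomp α) • Hcomp α

/-- The noncommutative Bernstein operator `𝔹_m = ∑_{i ≥ 0} (-1)^i H_{m+i} F_{1^i}^⊥`. On each
element of `NSym` only finitely many terms are nonzero. -/
def bernsteinU (m : ℤ) (f : NSym) : NSym :=
  ∑ᶠ i : ℕ, (-1 : ℚ) ^ i • (Hint (m + i) * perpU (Fcomp (List.replicate i 1)) f)

/-- The immaculate function `𝔖_α = 𝔹_{α₁} ⋯ 𝔹_{α_m}(1)` for `α ∈ ℤ^m`. -/
def immaculateU (α : List ℤ) : NSym := α.foldr bernsteinU 1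

/-- The uncoloring map `υ : NSym_A → NSym`, the linear map with `υ(H_I) = H_{wℓ(I)}`. -/
def uncolor {A : Type*} : NSymA A →ₗ[ℚ] NSym :=
  Finsupp.linearCombination ℚ (fun I : FreeMonoid (NWord A) =>
    Hcomp (wordLengths (FreeMonoid.toList I))) ∘ₗ
  (MonoidAlgebra.coeffLinearEquiv ℚ : NSymA A ≃ₗ[ℚ] _).toLinearMap

/-! The pairings take the values that define them. -/

theorem placeAt_succ {W : Type*} [AddMonoid W] {k : ℕ} (w : Fin (k + 1) → W)
    (j : Fin (k + 1) → ℕ) : placeAt w j =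
      Finsupp.single (j 0) (w 0) + placeAt (fun i => w i.succ) fun i => j i.succ := by
  simp [placeAt, List.ofFn_succ]

theorem placeAt_apply_of_notMem {W : Type*} [AddMonoid W] {k : ℕ} (w : Fin k → W) (j : Fin k → ℕ)
    (n : ℕ) (hn : ∀ i, j i ≠ n) : placeAt w j n = 0 := by
  induction k with
  | zero => simp [placeAt]
  | succ k ih =>
    rw [placeAt_succ, Finsupp.add_apply, ih _ _ fun i => hn i.succ,
      Finsupp.single_eq_of_ne (hn 0).symm, add_zero]

theorem placeAt_apply {W : Type*} [AddMonoid W] {k : ℕ} (w : Fin k → W) (j : Fin k → ℕ)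
    (hj : Function.Injective j) (i : Fin k) : placeAt w j (j i) = w i := by
  induction k with
  | zero => exact i.elim0
  | succ k ih =>
    rw [placeAt_succ, Finsupp.add_apply]
    refine Fin.cases ?_ (fun i => ?_) i
    · rw [placeAt_apply_of_notMem _ _ _ fun i h => Fin.succ_ne_zero i (hj h)]
      simp
    · rw [Finsupp.single_eq_of_ne fun h => Fin.succ_ne_zero i (hj h), zero_add]
      exact ih (fun i => w i.succ) (fun i => j i.succ) (fun a b h => Fin.succ_injective _ (hj h)) i

theorem placeAt_eq {W : Type*} [AddMonoid W] {k l : ℕ} (w : Fin k → W) (w' : Fin l → W)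
    (hw : ∀ i, w i ≠ 0) (hw' : ∀ i, w' i ≠ 0) (j : Fin k ↪o ℕ)
    (h : placeAt w j = placeAt w' fun i => (i : ℕ)) :
    ∃ e : k = l, (∀ i, w i = w' (Fin.cast e i)) ∧ ∀ i, j i = (i : ℕ) := by
  have hr : Set.range j = Set.range (fun i : Fin l => (i : ℕ)) := by
    ext n
    constructor
    · rintro ⟨i, rfl⟩
      by_contra hn
      apply hw i
      rw [← placeAt_apply w j j.injective i, h]
      exact placeAt_apply_of_notMem _ _ _ fun i' hi' => hn ⟨i', hi'⟩
    · rintro ⟨i, rfl⟩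
      by_contra hn
      apply hw' i
      rw [← placeAt_apply w' (fun i => (i : ℕ)) Fin.val_injective i, ← h]
      exact placeAt_apply_of_notMem _ _ _ fun i' hi' => hn ⟨i', hi'⟩
  have e : k = l := by
    have h1 := Set.card_range_of_injective j.injective
    have h2 := Set.card_range_of_injective (Fin.val_injective (n := l))
    simp only [Fintype.card_fin] at h1 h2
    rw [← h1, ← h2]
    simp only [hr]
  subst e
  have hj : (j : Fin k → ℕ) = fun i : Fin k => (i : ℕ) :=
    (StrictMono.range_inj j.strictMono Fin.val_strictMono).1 hr
  refine ⟨rfl, fun i => ?_, fun i => congrFun hj i⟩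
  rw [← placeAt_apply w j j.injective i, h, hj]
  exact placeAt_apply w' (fun i => (i : ℕ)) Fin.val_injective i

theorem formalSum_placeAt {W : Type*} [AddMonoid W] {k l : ℕ} (w : Fin k → W) (w' : Fin l → W)
    (hw : ∀ i, w i ≠ 0) (hw' : ∀ i, w' i ≠ 0) [Decidable (∃ e : k = l, ∀ i, w i = w' (Fin.cast e i))] :
    formalSum (fun j : Fin k ↪o ℕ => placeAt w j) (placeAt w' fun i => (i : ℕ)) =
      if ∃ e : k = l, ∀ i, w i = w' (Fin.cast e i) then 1 else 0 := by
  unfold formalSum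
  split_ifs with h
  · obtain ⟨rfl, h⟩ := h
    obtain rfl : w = w' := funext h
    have : Nat.card {j : Fin k ↪o ℕ // placeAt w j = placeAt w fun i => (i : ℕ)} = 1 := by
      rw [Nat.card_eq_one_iff_unique]
      refine ⟨⟨fun a b => Subtype.ext (RelEmbedding.ext fun i => ?_)⟩,
        ⟨⟨Fin.valOrderEmb k, rfl⟩⟩⟩
      obtain ⟨_, _, ha⟩ := placeAt_eq _ _ hw hw' a.1 a.2
      obtain ⟨_, _, hb⟩ := placeAt_eq _ _ hw hw' b.1 b.2
      rw [ha, hb]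
    rw [this, Nat.cast_one]
  · have : IsEmpty {j : Fin k ↪o ℕ // placeAt w j = placeAt w' fun i => (i : ℕ)} :=
      ⟨fun a => by
        obtain ⟨e, he, _⟩ := placeAt_eq _ _ hw hw' a.1 a.2
        exact h ⟨e, he⟩⟩
    simp

theorem pairing_H_M {A : Type*} [DecidableEq A] (I J : Sentence A) :
    pairing (H I) (M J) = if I = J then 1 else 0 := by
  have h0 : ∀ (K : Sentence A) i, wordAt K i ≠ 0 := fun K i h => (K.get i).2 h
  have h1 : pairing (H I) (M J) = M J (stdMonomial I) := by
    simp [pairing, H, MonoidAlgebra.of_apply, ColSeries.coeff]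
  classical
  rw [h1, M, stdMonomial, formalSum_placeAt _ _ (h0 J) (h0 I)]
  congr 1
  rw [eq_iff_iff]
  constructor
  · rintro ⟨e, h⟩
    exact (List.ext_get e fun n h1 h2 => Subtype.ext (h ⟨n, h1⟩)).symm
  · rintro rfl
    exact ⟨rfl, fun _ => rfl⟩

theorem pairingU_H_M (α β : Comp) : pairingU (Hcomp α) (Mcomp β) = if α = β then 1 else 0 := by
  have h0 : ∀ (γ : Comp) i, ((γ.get i : ℕ+) : ℕ) ≠ 0 := fun γ i => (γ.get i).ne_zero
  have h1 : pairingU (Hcomp α) (Mcomp β) = Mcomp β (stdExponent α) := by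
    simp [pairingU, Hcomp, MonoidAlgebra.of_apply, MvPowerSeries.coeff_apply]
  classical
  rw [h1, Mcomp, stdExponent, formalSum_placeAt _ _ (h0 β) (h0 α)]
  congr 1
  rw [eq_iff_iff]
  constructor
  · rintro ⟨e, h⟩
    exact (List.ext_get e fun n h1 h2 => PNat.coe_injective (h ⟨n, h1⟩)).symm
  · rintro rfl
    exact ⟨rfl, fun _ => rfl⟩

end ColoredImmaculate

end

open ColoredImmaculate

/-!
The coproduct of `NSym_A` dual to the product of series sends `H_K` to the sum of `H_I ⊗ H_S` over
all ways to cut every word of `K` into a prefix and a suffix, `I` and `S` being the sentences of the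
nonempty prefixes and suffixes (`splits`, `M_mul_M_apply`). Since this coproduct is coassociative
(`splitSum_coassoc`), everything reduces to sums over splittings; in particular
`𝔹_v H_K = ∑_{(I, S)} ∑_{Q ⪯ S} (-1)^ℓ(Q) H_{(v w(Q^r), I)}` (`bernsteinA_eq`).

Duality is proved by computing the adjoint of `𝔹_v` on dual immaculate functions. In a tableau the
smallest possible entry fills a prefix `x` of the first row and nothing else, and once it is removed
the rest of the first row is no longer tied to the other rows. Hence the coefficient of a sentence
`(x, K)` in `𝔖*_{(u, J)}` is that of `K` in `𝔖*_J h_z` if `u = x z`, and `0` if `x` is not a prefix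
of `u`, where `h_z` is the sum of all `M_S` with `w(S) = z` (`card_fiber`). Pairing `𝔹_v f` with
`𝔖*_{(u, J)}` therefore produces, for `u = v y`, the product of `𝔖*_J` with
`∑ h_z ∑_{Q ⪯ S, w(Q^r) = y'} (-1)^ℓ(Q) M_S` over the factorizations `y = y' z`. That sum is an
antipode identity: it vanishes unless `y` is empty, because moving the first word of `Q` into the
prefix is a sign-reversing matching (`splitSum_altRefSum_eq_zero`). So
`⟨𝔹_v f, 𝔖*_{(u, J)}⟩ = δ_{u,v} ⟨f, 𝔖*_J⟩` (`pairing_bernsteinA_cons`), and duality follows by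
induction on the length.

Duality makes both families linearly independent. The dual immaculate functions of sentences with
`n` letters lie in the span of the equally many `M_K` with `n` letters, so they span it
(`span_dualImmaculateA_ofSize`). As the pairing separates the elements of `NSym_A`, the expansion
`H_K = ∑_J ⟨H_K, 𝔖*_J⟩ 𝔖_J` can be checked by pairing both sides with all `𝔖*_J`.

Over a one-letter alphabet words are determined by their lengths, and uncoloring intertwines the
colored and the uncolored perp operators (`perpU_uncolor`). In `𝔹_v` the factor `H_{v w(Q^r)}` then
depends on `S` only, and `∑_{Q ⪯ S} (-1)^ℓ(Q)` vanishes unless all words of `S` have length one,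
which leaves exactly the terms of the uncolored Bernstein operator (`uncolor_bernsteinA`).
-/


noncomputable section

namespace ColoredImmaculate

variable {A : Type*}

/-! ### Splitting words and sentences -/

/-- Prepend a word to a sentence, dropping it when it is empty. -/
def consWord : Word A → Sentence A → Sentence A
  | [], S => S
  | x :: w, S => ⟨x :: w, List.cons_ne_nil x w⟩ :: S

@[simp] theorem consWord_nil (S : Sentence A) : consWord [] S = S := rfl

theorem consWord_of_ne {w : Word A} (h : w ≠ []) (S : Sentence A) :
    consWord w S = ⟨w, h⟩ :: S := by
  cases w with
  | nil => exact absurd rfl h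
  | cons x w => rfl

theorem cons_eq_consWord (w : NWord A) (S : Sentence A) : w :: S = consWord w.1 S :=
  (consWord_of_ne w.2 S).symm

@[simp] theorem maxWord_nil : maxWord ([] : Sentence A) = [] := rfl

@[simp] theorem maxWord_cons (w : NWord A) (S : Sentence A) :
    maxWord (w :: S) = w.1 ++ maxWord S := by simp [maxWord]

@[simp] theorem maxWord_append (S T : Sentence A) :
    maxWord (S ++ T) = maxWord S ++ maxWord T := by simp [maxWord]

@[simp] theorem maxWord_consWord (w : Word A) (S : Sentence A) :
    maxWord (consWord w S) = w ++ maxWord S := by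
  cases w with
  | nil => rfl
  | cons x w => simp [consWord]

theorem maxWord_eq_nil {S : Sentence A} (h : maxWord S = []) : S = [] := by
  cases S with
  | nil => rfl
  | cons w S => exact absurd (List.append_eq_nil_iff.1 ((maxWord_cons w S).symm.trans h)).1 w.2

theorem length_maxWord_reverse (S : Sentence A) :
    (maxWord S.reverse).length = (maxWord S).length := by
  induction S with
  | nil => rfl
  | cons w S ih => simp [ih, add_comm]

section ListSum

variable {ι κ X : Type*} [AddCommMonoid X]

theorem sum_map_sum_comm (l : List ι) (l' : List κ) (F : ι → κ → X) :
    (l.map fun a => (l'.map fun b => F a b).sum).sum =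
      (l'.map fun b => (l.map fun a => F a b).sum).sum := by
  induction l with
  | nil => simp
  | cons a l ih => simp [ih, List.sum_map_add]

/-- A locally finite sum commutes with a finite sum. -/
theorem finsum_sum_map {β : Type*} (l : List ι) (g : β → ι → X)
    (h : ∀ a ∈ l, (Function.support fun i => g i a).Finite) :
    (Function.support fun i => (l.map (g i)).sum).Finite ∧
      ∑ᶠ i, (l.map (g i)).sum = (l.map fun a => ∑ᶠ i, g i a).sum := by
  induction l with
  | nil => simp
  | cons a l ih =>
    have h1 := h a (by simp)
    obtain ⟨h2, h3⟩ := ih fun b hb => h b (by simp [hb])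
    simp only [List.map_cons, List.sum_cons]
    refine ⟨(h1.union h2).subset (Function.support_add _ _), ?_⟩
    rw [finsum_add_distrib h1 h2, h3]

end ListSum

/-- All factorizations `w = ab` of a word, as pairs `(a, b)`. -/
def wordSplits : Word A → List (Word A × Word A)
  | [] => [([], [])]
  | x :: w => ([], x :: w) :: (wordSplits w).map fun p => (x :: p.1, p.2)

theorem append_of_mem_wordSplits {w : Word A} {p : Word A × Word A} (h : p ∈ wordSplits w) :
    p.1 ++ p.2 = w := by
  induction w generalizing p with
  | nil => simp_all [wordSplits]
  | cons x w ih =>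
    simp only [wordSplits, List.mem_cons, List.mem_map] at h
    rcases h with rfl | ⟨q, hq, rfl⟩
    · rfl
    · simp [ih hq]

theorem mem_wordSplits {w : Word A} {p : Word A × Word A} :
    p ∈ wordSplits w ↔ p.1 ++ p.2 = w := by
  refine ⟨append_of_mem_wordSplits, ?_⟩
  obtain ⟨a, b⟩ := p
  rintro rfl
  induction a with
  | nil => cases b <;> simp [wordSplits]
  | cons x a ih => simp [wordSplits]; simpa using ih

theorem nodup_wordSplits (w : Word A) : (wordSplits w).Nodup := by
  induction w with
  | nil => simp [wordSplits]
  | cons x w ih =>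
    refine List.nodup_cons.2 ⟨by simp, ih.map fun p q h => ?_⟩
    simp only [Prod.mk.injEq, List.cons.injEq, true_and] at h
    exact Prod.ext h.1 h.2

section Sums

variable {X : Type*} [AddCommMonoid X]

/-- The sum of `F a b` over all factorizations `w = ab`. -/
def wordSplitSum (w : Word A) (F : Word A → Word A → X) : X :=
  ((wordSplits w).map fun p => F p.1 p.2).sum

theorem wordSplitSum_nil (F : Word A → Word A → X) : wordSplitSum [] F = F [] [] := by
  simp [wordSplitSum, wordSplits]

theorem wordSplitSum_cons (x : A) (w : Word A) (F : Word A → Word A → X) :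
    wordSplitSum (x :: w) F = F [] (x :: w) + wordSplitSum w fun a b => F (x :: a) b := by
  simp [wordSplitSum, wordSplits, Function.comp_def]

theorem wordSplitSum_add (w : Word A) (F G : Word A → Word A → X) :
    wordSplitSum w (fun a b => F a b + G a b) = wordSplitSum w F + wordSplitSum w G :=
  List.sum_map_add

theorem wordSplitSum_coassoc (w : Word A) (F : Word A → Word A → Word A → X) :
    (wordSplitSum w fun a b => wordSplitSum a fun c d => F c d b) =
      wordSplitSum w fun a b => wordSplitSum b fun c d => F a c d := by
  induction w generalizing F with
  | nil => simp only [wordSplitSum_nil]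
  | cons x w ih =>
    simp only [wordSplitSum_cons, wordSplitSum_nil, wordSplitSum_add, ih, add_assoc]

theorem wordSplitSum_eq_of_right_nil (w : Word A) (F : Word A → Word A → X)
    (h : ∀ a b, b ≠ [] → F a b = 0) : wordSplitSum w F = F w [] := by
  induction w generalizing F with
  | nil => exact wordSplitSum_nil F
  | cons x w ih =>
    rw [wordSplitSum_cons, h _ _ (List.cons_ne_nil x w), zero_add]
    exact ih _ fun a b => h _ b

end Sums

/-- All ways to write every word `k` of a sentence as a product `k = ab`: the pairs consisting of
the sentence of the nonempty prefixes `a` and the sentence of the nonempty suffixes `b`, with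
multiplicity. This is the coproduct of `NSym_A` dual to the product of series. -/
def splits : Sentence A → List (Sentence A × Sentence A)
  | [] => [([], [])]
  | w :: K => (wordSplits w.1).flatMap fun p =>
      (splits K).map fun q => (consWord p.1 q.1, consWord p.2 q.2)

theorem length_of_mem_splits {K : Sentence A} {p : Sentence A × Sentence A} (h : p ∈ splits K) :
    (maxWord p.1).length + (maxWord p.2).length = (maxWord K).length := by
  induction K generalizing p with
  | nil => simp_all [splits]
  | cons w K ih =>
    simp only [splits, List.mem_flatMap, List.mem_map] at h
    obtain ⟨q, hq, r, hr, rfl⟩ := h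
    have h1 := congrArg List.length (append_of_mem_wordSplits hq)
    have h2 := ih hr
    simp only [List.length_append] at h1
    simp only [maxWord_consWord, maxWord_cons, List.length_append]
    omega

section Sums

variable {X : Type*} [AddCommMonoid X]

/-- The sum of `G I S` over all splittings `(I, S)` of the sentence `K`. -/
def splitSum (K : Sentence A) (G : Sentence A → Sentence A → X) : X :=
  ((splits K).map fun p => G p.1 p.2).sum

@[simp] theorem splitSum_nil (G : Sentence A → Sentence A → X) : splitSum [] G = G [] [] := by
  simp [splitSum, splits]

theorem splitSum_consWord (w : Word A) (K : Sentence A) (G : Sentence A → Sentence A → X) :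
    splitSum (consWord w K) G = wordSplitSum w fun a b =>
      splitSum K fun I S => G (consWord a I) (consWord b S) := by
  cases w with
  | nil => simp [wordSplitSum_nil]
  | cons x w =>
    simp [splitSum, splits, wordSplitSum, consWord, List.flatMap_def, List.sum_flatten,
      Function.comp_def]

theorem splitSum_congr {K : Sentence A} {F G : Sentence A → Sentence A → X}
    (h : ∀ I S, (maxWord I).length + (maxWord S).length = (maxWord K).length → F I S = G I S) :
    splitSum K F = splitSum K G :=
  congrArg List.sum (List.map_congr_left fun _ hp => h _ _ (length_of_mem_splits hp))

theorem splitSum_zero (K : Sentence A) : splitSum K (fun _ _ => (0 : X)) = 0 := by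
  simp [splitSum]

theorem map_splitSum {Y F : Type*} [AddCommMonoid Y] [FunLike F X Y] [AddMonoidHomClass F X Y]
    (φ : F) (K : Sentence A) (G : Sentence A → Sentence A → X) :
    φ (splitSum K G) = splitSum K fun I S => φ (G I S) := by
  simp [splitSum, map_list_sum, Function.comp_def]

theorem finsum_splitSum {β : Type*} (K : Sentence A) (g : β → Sentence A → Sentence A → X)
    (h : ∀ I S, (Function.support fun i => g i I S).Finite) :
    (Function.support fun i => splitSum K (g i)).Finite ∧
      ∑ᶠ i, splitSum K (g i) = splitSum K fun I S => ∑ᶠ i, g i I S :=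
  finsum_sum_map (splits K) (fun i p => g i p.1 p.2) fun p _ => h p.1 p.2

theorem splitSum_wordSplitSum_comm (K : Sentence A) (v : Word A)
    (F : Sentence A → Sentence A → Word A → Word A → X) :
    (splitSum K fun I S => wordSplitSum v fun a b => F I S a b) =
      wordSplitSum v fun a b => splitSum K fun I S => F I S a b :=
  sum_map_sum_comm (splits K) (wordSplits v) fun p q => F p.1 p.2 q.1 q.2

theorem splitSum_coassoc (K : Sentence A) (G : Sentence A → Sentence A → Sentence A → X) :
    (splitSum K fun R S => splitSum R fun I J => G I J S) =
      splitSum K fun I R => splitSum R fun J S => G I J S := by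
  induction K generalizing G with
  | nil => simp
  | cons w K ih =>
    rw [cons_eq_consWord]
    simp only [splitSum_consWord, splitSum_wordSplitSum_comm]
    rw [wordSplitSum_coassoc w fun a b c => splitSum K fun R S => splitSum R fun I J =>
      G (consWord a I) (consWord b J) (consWord c S)]
    simp only [ih]

/-- The counit law: exactly one splitting has an empty second component. -/
theorem splitSum_eq_of_right_nil (K : Sentence A) (G : Sentence A → Sentence A → X)
    (h : ∀ I S, S ≠ [] → G I S = 0) : splitSum K G = G K [] := by
  induction K generalizing G with
  | nil => simp
  | cons w K ih =>
    rw [cons_eq_consWord, splitSum_consWord, wordSplitSum_eq_of_right_nil]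
    · exact ih (fun I S => G (consWord w.1 I) S) fun I S => h _ S
    · intro a b hb
      rw [← splitSum_zero K]
      exact splitSum_congr fun I S _ => h _ _ (by simp [consWord_of_ne hb])

end Sums

/-! ### Refinements of sentences -/

/-- The list of all sentences refining `S`: the first word of a refinement is a nonempty prefix of
the first word of `S`, and the other words refine what is left of `S`. -/
def refinements : Sentence A → List (Sentence A)
  | [] => [[]]
  | ⟨[], _⟩ :: _ => []
  | ⟨x :: w, _⟩ :: S => (wordSplits w).attach.flatMap fun p =>
      (refinements (consWord p.1.2 S)).map (⟨x :: p.1.1, List.cons_ne_nil _ _⟩ :: ·)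
termination_by S => (maxWord S).length
decreasing_by
  have h := congrArg List.length (append_of_mem_wordSplits p.2)
  simp only [List.length_append] at h
  simp
  omega

theorem refinements_nil : refinements ([] : Sentence A) = [[]] := by
  rw [refinements]

theorem refinements_cons (x : A) (w : Word A) (h : x :: w ≠ []) (S : Sentence A) :
    refinements (⟨x :: w, h⟩ :: S) = (wordSplits w).flatMap fun p =>
      (refinements (consWord p.2 S)).map (⟨x :: p.1, List.cons_ne_nil _ _⟩ :: ·) := by
  rw [refinements]
  simp only [List.flatMap_def]
  rw [List.attach_map_val (l := wordSplits w) (f := fun p : Word A × Word A =>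
    (refinements (consWord p.2 S)).map (⟨x :: p.1, List.cons_ne_nil _ _⟩ :: ·))]

/-- Induction that replaces a sentence by what is left of it when a nonempty prefix of its first
word is removed. -/
theorem prefix_induction {P : Sentence A → Prop} (nil : P [])
    (cons : ∀ (x : A) (w : Word A) (h : x :: w ≠ []) (S : Sentence A),
      (∀ a b, a ++ b = w → P (consWord b S)) → P (⟨x :: w, h⟩ :: S)) (S : Sentence A) : P S := by
  induction hn : (maxWord S).length using Nat.strong_induction_on generalizing S with
  | _ n ih =>
    match S, hn with
    | [], _ => exact nil
    | ⟨[], h⟩ :: _, _ => exact absurd rfl h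
    | ⟨x :: w, h⟩ :: S, hn =>
      refine cons x w h S fun a b hab => ih _ ?_ _ rfl
      subst hab
      simp at hn ⊢
      omega

theorem nodup_refinements (S : Sentence A) : (refinements S).Nodup := by
  induction S using prefix_induction with
  | nil => simp [refinements_nil]
  | cons x w h S ih =>
    rw [refinements_cons, List.nodup_flatMap]
    constructor
    · rintro ⟨a, b⟩ hp
      exact (ih a b (append_of_mem_wordSplits hp)).map (List.cons_injective)
    · refine (List.nodup_iff_pairwise_ne.1 (nodup_wordSplits w)).imp_of_mem ?_
      rintro ⟨a, b⟩ ⟨a', b'⟩ hp hp' hne Q hQ hQ'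
      simp only [List.mem_map] at hQ hQ'
      obtain ⟨R, -, rfl⟩ := hQ
      obtain ⟨R', -, hR⟩ := hQ'
      have h1 : a' = a := by simpa using (List.cons.inj hR).1
      have h2 := (append_of_mem_wordSplits hp).trans (append_of_mem_wordSplits hp').symm
      subst h1
      exact hne (by simpa using h2)

theorem partialSums_nil : partialSums [] = ∅ := by
  ext s
  simp only [partialSums, Set.mem_ofPred_eq, List.length_nil, Set.mem_empty_iff_false, iff_false]
  rintro ⟨k, h1, h2, -⟩
  omega

theorem partialSums_cons (a : ℕ+) (α : Comp) :
    partialSums (a :: α) = insert (a : ℕ) ((fun s => (a : ℕ) + s) '' partialSums α) := by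
  ext s
  simp only [partialSums, Set.mem_ofPred_eq, List.length_cons, Set.mem_insert_iff, Set.mem_image]
  constructor
  · rintro ⟨k, h1, h2, rfl⟩
    obtain ⟨k, rfl⟩ : ∃ k', k = k' + 1 := ⟨k - 1, by omega⟩
    rcases Nat.eq_zero_or_pos k with rfl | hk
    · exact Or.inl (by simp)
    · exact Or.inr ⟨_, ⟨k, hk, by omega, rfl⟩, by simp⟩
  · rintro (rfl | ⟨_, ⟨k, h1, h2, rfl⟩, rfl⟩)
    · exact ⟨1, le_rfl, by omega, by simp⟩
    · exact ⟨k + 1, by omega, by omega, by simp⟩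

theorem pos_of_mem_partialSums {α : Comp} {s : ℕ} (h : s ∈ partialSums α) : 0 < s := by
  cases α with
  | nil => simp [partialSums_nil] at h
  | cons a α =>
    rw [partialSums_cons] at h
    rcases h with rfl | ⟨t, -, rfl⟩
    · exact a.pos
    · exact Nat.add_pos_left a.pos t

/-- The length of a nonempty word as a positive integer. -/
def wordLength (w : NWord A) : ℕ+ := ⟨w.1.length, List.length_pos_iff.2 w.2⟩

@[simp] theorem coe_wordLength (w : NWord A) : (wordLength w : ℕ) = w.1.length := rfl

@[simp] theorem wordLengths_nil : wordLengths ([] : Sentence A) = [] := rfl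

@[simp] theorem wordLengths_cons (w : NWord A) (S : Sentence A) :
    wordLengths (w :: S) = wordLength w :: wordLengths S := rfl

theorem sum_wordLengths (S : Sentence A) :
    ((wordLengths S).map PNat.val).sum = (maxWord S).length := by
  induction S with
  | nil => rfl
  | cons w S ih =>
    rw [wordLengths_cons, List.map_cons, List.sum_cons, ih, maxWord_cons, List.length_append]
    rfl

theorem refines_iff (Q S : Sentence A) : Sentence.Refines Q S ↔
    maxWord Q = maxWord S ∧ partialSums (wordLengths S) ⊆ partialSums (wordLengths Q) := by
  simp only [Sentence.Refines, Comp.Refines, sum_wordLengths]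
  constructor
  · rintro ⟨h1, -, h3⟩
    exact ⟨h1, h3⟩
  · rintro ⟨h1, h3⟩
    exact ⟨h1, by rw [h1], h3⟩

theorem refines_nil_left (S : Sentence A) : Sentence.Refines [] S ↔ S = [] := by
  rw [refines_iff]
  refine ⟨fun h => maxWord_eq_nil h.1.symm, ?_⟩
  rintro rfl
  simp

theorem refines_nil_right (Q : Sentence A) : Sentence.Refines Q [] ↔ Q = [] := by
  rw [refines_iff]
  refine ⟨fun h => maxWord_eq_nil h.1, ?_⟩
  rintro rfl
  simp

/-- Splitting the first word `s = q b` into `q` and `b` adds at most the partial sum `|q|`. -/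
theorem partialSums_cons_append (q : NWord A) (b : Word A) (s : NWord A) (h : s.1 = q.1 ++ b)
    (S : Sentence A) :
    insert q.1.length (partialSums (wordLengths (s :: S))) = insert q.1.length
      ((fun t => q.1.length + t) '' partialSums (wordLengths (consWord b S))) := by
  cases b with
  | nil =>
    rw [wordLengths_cons, partialSums_cons]
    simp [h]
  | cons x b =>
    rw [wordLengths_cons, partialSums_cons, consWord, wordLengths_cons, partialSums_cons]
    simp [h, Set.image_insert_eq, Set.image_image, add_assoc]

/-- The recursion for the refinement order that `refinements` follows. -/
theorem refines_cons_cons (q s : NWord A) (Q S : Sentence A) :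
    Sentence.Refines (q :: Q) (s :: S) ↔
      ∃ b, s.1 = q.1 ++ b ∧ Sentence.Refines Q (consWord b S) := by
  have hQ : partialSums (wordLengths (q :: Q)) = insert q.1.length
      ((fun t => q.1.length + t) '' partialSums (wordLengths Q)) := by
    rw [wordLengths_cons, partialSums_cons]
    rfl
  have key : ∀ b, s.1 = q.1 ++ b →
      (partialSums (wordLengths (s :: S)) ⊆ partialSums (wordLengths (q :: Q)) ↔
        partialSums (wordLengths (consWord b S)) ⊆ partialSums (wordLengths Q)) := by
    intro b hb
    have h0 : q.1.length ∈ partialSums (wordLengths (q :: Q)) := by rw [hQ]; simp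
    have h1 := partialSums_cons_append q b s hb S
    have h2 : partialSums (wordLengths (s :: S)) ⊆ partialSums (wordLengths (q :: Q)) ↔
        insert q.1.length (partialSums (wordLengths (s :: S))) ⊆
          partialSums (wordLengths (q :: Q)) := by
      rw [Set.insert_subset_iff, and_iff_right h0]
    rw [h2, h1, hQ, Set.insert_subset_insert_iff, Set.image_subset_image_iff]
    · exact fun _ _ => Nat.add_left_cancel
    · rintro ⟨t, ht, h⟩
      have := pos_of_mem_partialSums ht
      simp only at h
      omega
  simp only [refines_iff]
  constructor
  · rintro ⟨h1, h2⟩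
    have h3 : s.1.length ∈ partialSums (wordLengths (q :: Q)) :=
      h2 (by rw [wordLengths_cons, partialSums_cons]; simp)
    have h4 : q.1.length ≤ s.1.length := by
      rw [hQ] at h3
      rcases h3 with h | ⟨t, -, h⟩
      · exact h.ge
      · exact h ▸ Nat.le_add_right _ _
    simp only [maxWord_cons] at h1
    obtain ⟨b, hb⟩ : q.1 <+: s.1 := List.prefix_of_prefix_length_le
      (List.prefix_append q.1 (maxWord Q)) (h1 ▸ List.prefix_append s.1 (maxWord S)) h4
    refine ⟨b, hb.symm, ?_, (key b hb.symm).1 h2⟩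
    rw [← hb, List.append_assoc] at h1
    simpa using h1
  · rintro ⟨b, hb, h1, h2⟩
    exact ⟨by simp [hb, h1], (key b hb).2 h2⟩

theorem mem_refinements {Q S : Sentence A} : Q ∈ refinements S ↔ Sentence.Refines Q S := by
  induction S using prefix_induction generalizing Q with
  | nil => simp [refinements_nil, refines_nil_right]
  | cons x w h S ih =>
    rw [refinements_cons]
    cases Q with
    | nil => simp [refines_nil_left]
    | cons q Q =>
      rw [refines_cons_cons]
      simp only [List.mem_flatMap, List.mem_map, List.cons.injEq]
      constructor
      · rintro ⟨⟨a, b⟩, hp, R, hR, rfl, rfl⟩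
        have hab := append_of_mem_wordSplits hp
        exact ⟨b, by simpa using hab.symm, (ih a b hab).1 hR⟩
      · rintro ⟨b, hb, hQ⟩
        obtain ⟨q, hq⟩ := q
        cases q with
        | nil => exact absurd rfl hq
        | cons y a =>
          simp only [List.cons_append, List.cons.injEq] at hb
          obtain ⟨rfl, rfl⟩ := hb
          exact ⟨(a, b), mem_wordSplits.2 rfl, Q, (ih a b rfl).2 hQ, rfl, rfl⟩

/-! ### Alternating sums over refinements -/

section Sums

variable {X : Type*} [AddCommGroup X]

theorem neg_list_sum (l : List X) : -l.sum = (l.map fun x => -x).sum :=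
  map_list_sum (negAddMonoidHom : X →+ X) l

theorem neg_wordSplitSum (w : Word A) (F : Word A → Word A → X) :
    -wordSplitSum w F = wordSplitSum w fun a b => -F a b := by
  simp [wordSplitSum, neg_list_sum, Function.comp_def]

theorem neg_splitSum (K : Sentence A) (G : Sentence A → Sentence A → X) :
    -splitSum K G = splitSum K fun I S => -G I S :=
  map_splitSum (negAddMonoidHom : X →+ X) K G

variable [Module ℚ X]

/-- The sum of `(-1) ^ ℓ(Q) • g Q` over all refinements `Q` of `S`. -/
def altRefSum (S : Sentence A) (g : Sentence A → X) : X :=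
  ((refinements S).map fun Q => (-1 : ℚ) ^ Q.length • g Q).sum

@[simp] theorem altRefSum_nil (g : Sentence A → X) : altRefSum [] g = g [] := by
  simp [altRefSum, refinements_nil]

theorem altRefSum_cons (x : A) (w : Word A) (h : x :: w ≠ []) (S : Sentence A)
    (g : Sentence A → X) : altRefSum (⟨x :: w, h⟩ :: S) g =
      -wordSplitSum w fun a b =>
        altRefSum (consWord b S) fun Q => g (⟨x :: a, List.cons_ne_nil _ _⟩ :: Q) := by
  rw [altRefSum, refinements_cons, neg_wordSplitSum]
  simp only [wordSplitSum, altRefSum, neg_list_sum, List.flatMap_def, List.map_flatten,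
    List.sum_flatten, List.map_map, Function.comp_def, List.length_cons, pow_succ, mul_neg, mul_one,
    neg_smul]

theorem map_altRefSum {Y : Type*} [AddCommGroup Y] [Module ℚ Y] (φ : X →ₗ[ℚ] Y) (S : Sentence A)
    (g : Sentence A → X) : φ (altRefSum S g) = altRefSum S fun Q => φ (g Q) := by
  simp [altRefSum, map_list_sum, Function.comp_def]

/-- The alternating sum over the refinements of `S` as a sum over all sentences. -/
theorem finsum_refines (S : Sentence A) [∀ Q, Decidable (Sentence.Refines Q S)]
    (g : Sentence A → X) :
    (Function.support fun Q : Sentence A =>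
      (-1 : ℚ) ^ Q.length • if Sentence.Refines Q S then g Q else 0).Finite ∧
      (∑ᶠ Q : Sentence A, (-1 : ℚ) ^ Q.length • if Sentence.Refines Q S then g Q else 0) =
        altRefSum S g := by
  classical
  have hs : (Function.support fun Q : Sentence A =>
      (-1 : ℚ) ^ Q.length • if Sentence.Refines Q S then g Q else 0) ⊆
      ((refinements S).toFinset : Set (Sentence A)) := by
    intro Q hQ
    by_contra hn
    rw [List.coe_toFinset, Set.mem_ofPred_eq, mem_refinements] at hn
    exact hQ (by simp [hn])
  refine ⟨(Finset.finite_toSet _).subset hs, ?_⟩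
  rw [finsum_eq_sum_of_support_subset _ hs, List.sum_toFinset _ (nodup_refinements S), altRefSum]
  refine congrArg List.sum (List.map_congr_left fun Q hQ => ?_)
  rw [if_pos (mem_refinements.1 hQ)]

/-- The antipode identity behind the Bernstein operators: peeling off the first word of each
refinement pairs the terms in which the prefix of the first word of `K` is empty with those in
which it is not, with opposite signs. -/
theorem splitSum_altRefSum_eq_zero {K : Sentence A} (hK : K ≠ []) (g : Word A → X) :
    (splitSum K fun I S => altRefSum S fun Q => g (maxWord Q.reverse ++ maxWord I)) = 0 := by
  match K, hK with
  | ⟨[], h⟩ :: _, _ => exact absurd rfl h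
  | ⟨x :: w, h⟩ :: K, _ =>
    rw [cons_eq_consWord, splitSum_consWord, wordSplitSum_cons]
    simp only [consWord_nil, maxWord_consWord, consWord_of_ne h, altRefSum_cons]
    -- The first summand has the empty prefix of the first word in `I`; by `altRefSum_cons` it is
    -- the negative of the second one.
    rw [← neg_splitSum, splitSum_wordSplitSum_comm]
    simp

theorem altRefSum_const_of_forall_length {S : Sentence A} (h : ∀ w ∈ S, w.1.length = 1) (c : X) :
    (altRefSum S fun _ => c) = (-1 : ℚ) ^ S.length • c := by
  induction S with
  | nil => simp
  | cons w S ih =>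
    obtain ⟨w, hw⟩ := w
    match w, hw with
    | [], hw => exact absurd rfl hw
    | [x], hw =>
      rw [altRefSum_cons, wordSplitSum_nil, consWord_nil, ih fun v hv => h v (by simp [hv])]
      simp [pow_succ]
    | x :: y :: w, hw => simpa using h _ List.mem_cons_self

/-- If the first word `x y ⋯` of `S` has at least two letters, the refinements beginning with the
word `x` cancel against those in which `x` is joined to the next word. -/
theorem altRefSum_const_eq_zero {S : Sentence A} {w : NWord A} (hwS : w ∈ S)
    (hw : w.1.length ≠ 1) (c : X) : (altRefSum S fun _ => c) = 0 := by
  induction S with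
  | nil => simp at hwS
  | cons v S ih =>
    obtain ⟨v, hv⟩ := v
    match v, hv with
    | [], hv => exact absurd rfl hv
    | [x], hv =>
      rw [altRefSum_cons, wordSplitSum_nil, consWord_nil, ih, neg_zero]
      rcases List.mem_cons.1 hwS with rfl | h
      · exact absurd rfl hw
      · exact h
    | x :: y :: v, hv =>
      rw [altRefSum_cons, wordSplitSum_cons, consWord, altRefSum_cons, neg_add_cancel, neg_zero]

end Sums

/-! ### Monomials and products of series -/

section Monomials

variable {W : Type*} [AddMonoid W]

/-- The monomial whose value at `0` is `a` and whose other values are those of `p`, shifted. -/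
def consMonomial (a : W) (p : ℕ →₀ W) : ℕ →₀ W :=
  Finsupp.single 0 a + p.embDomain ⟨Nat.succ, Nat.succ_injective⟩

@[simp] theorem consMonomial_zero (a : W) (p : ℕ →₀ W) : consMonomial a p 0 = a := by
  rw [consMonomial, Finsupp.add_apply, Finsupp.single_eq_same, Finsupp.embDomain_of_notMem_range,
    add_zero]
  rintro ⟨n, hn⟩
  exact Nat.succ_ne_zero n hn

@[simp] theorem consMonomial_succ (a : W) (p : ℕ →₀ W) (n : ℕ) :
    consMonomial a p (n + 1) = p n := by
  rw [consMonomial, Finsupp.add_apply, Finsupp.single_eq_of_ne (Nat.succ_ne_zero n), zero_add]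
  exact Finsupp.embDomain_apply_self ⟨Nat.succ, Nat.succ_injective⟩ p n

theorem eq_consMonomial_iff {m p : ℕ →₀ W} {a : W} :
    m = consMonomial a p ↔ m 0 = a ∧ ∀ n, m (n + 1) = p n := by
  constructor
  · rintro rfl
    simp
  · rintro ⟨h0, h⟩
    ext n
    cases n with
    | zero => simpa using h0
    | succ n => simpa using h n

theorem exists_eq_consMonomial (m : ℕ →₀ W) : ∃ a p, m = consMonomial a p :=
  ⟨m 0, m.comapDomain Nat.succ Nat.succ_injective.injOn, eq_consMonomial_iff.2 ⟨rfl, fun _ => rfl⟩⟩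

theorem consMonomial_inj {a b : W} {p q : ℕ →₀ W} :
    consMonomial a p = consMonomial b q ↔ a = b ∧ p = q := by
  rw [eq_consMonomial_iff]
  simp [DFunLike.ext_iff]

theorem consMonomial_add (a b : W) (p q : ℕ →₀ W) :
    consMonomial a p + consMonomial b q = consMonomial (a + b) (p + q) := by
  rw [eq_consMonomial_iff]
  simp

theorem consMonomial_zero_zero : consMonomial (0 : W) 0 = 0 :=
  (eq_consMonomial_iff.2 (by simp)).symm

theorem consMonomial_zero_single (n : ℕ) (a : W) :
    consMonomial 0 (Finsupp.single n a) = Finsupp.single (n + 1) a := by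
  refine (eq_consMonomial_iff.2 ⟨by simp, fun k => ?_⟩).symm
  simp [Finsupp.single_apply]

theorem consMonomial_zero_right (a : W) : consMonomial a 0 = Finsupp.single 0 a := by
  simp [consMonomial]

/-- Induction on monomials, one variable at a time. -/
theorem monomial_induction {P : (ℕ →₀ W) → Prop} (zero : P 0)
    (cons : ∀ a p, P p → P (consMonomial a p)) (m : ℕ →₀ W) : P m := by
  have key : ∀ (N : ℕ) (m : ℕ →₀ W), (∀ n, N ≤ n → m n = 0) → P m := by
    intro N
    induction N with
    | zero =>
      intro m hm
      rwa [show m = 0 from Finsupp.ext fun n => hm n (Nat.zero_le n)]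
    | succ N ih =>
      intro m hm
      obtain ⟨a, p, rfl⟩ := exists_eq_consMonomial m
      exact cons a p (ih p fun n hn => by simpa using hm (n + 1) (by omega))
  obtain ⟨N, hN⟩ := m.support.exists_nat_subset_range
  refine key N m fun n hn => ?_
  by_contra h
  have := hN (Finsupp.mem_support_iff.2 h)
  simp at this
  omega

theorem consMonomial_placeAt {k : ℕ} (a : W) (w : Fin k → W) (j : Fin k → ℕ) :
    consMonomial a (placeAt w j) =
      placeAt (Fin.cons a w : Fin (k + 1) → W) (Fin.cons 0 fun i => j i + 1) := by
  rw [placeAt_succ]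
  simp only [Fin.cons_zero, Fin.cons_succ]
  rw [← consMonomial_zero_right, ← add_zero a, ← zero_add (placeAt w j), ← consMonomial_add]
  simp only [add_zero]
  congr 1
  induction k with
  | zero => simp [placeAt, consMonomial_zero_zero]
  | succ k ih =>
    rw [placeAt_succ, placeAt_succ, ← ih, ← consMonomial_zero_single, consMonomial_add, add_zero]

theorem range_eq_of_placeAt_eq {k l : ℕ} {w : Fin k → W} {w' : Fin l → W}
    (hw : ∀ i, w i ≠ 0) (j : Fin k ↪o ℕ) (j' : Fin l ↪o ℕ) (h : placeAt w j = placeAt w' j') :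
    Set.range j ⊆ Set.range j' := by
  rintro n ⟨i, rfl⟩
  by_contra hn
  apply hw i
  rw [← placeAt_apply w j j.injective i, h]
  exact placeAt_apply_of_notMem _ _ _ fun i' hi' => hn ⟨i', hi'⟩

/-- A monomial determines its sequence of nonzero values and their positions. -/
theorem placeAt_unique {k l : ℕ} (w : Fin k → W) (w' : Fin l → W)
    (hw : ∀ i, w i ≠ 0) (hw' : ∀ i, w' i ≠ 0) (j : Fin k ↪o ℕ) (j' : Fin l ↪o ℕ)
    (h : placeAt w j = placeAt w' j') :
    ∃ e : k = l, (∀ i, w i = w' (Fin.cast e i)) ∧ ∀ i, j i = j' (Fin.cast e i) := by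
  have hr := (range_eq_of_placeAt_eq hw j j' h).antisymm (range_eq_of_placeAt_eq hw' j' j h.symm)
  have e : k = l := by
    have h1 := Set.card_range_of_injective j.injective
    have h2 := Set.card_range_of_injective j'.injective
    simp only [Fintype.card_fin] at h1 h2
    rw [← h1, ← h2]
    simp only [hr]
  subst e
  have hj : (j : Fin k → ℕ) = j' := (StrictMono.range_inj j.strictMono j'.strictMono).1 hr
  refine ⟨rfl, fun i => ?_, fun i => congrFun hj i⟩
  rw [← placeAt_apply w j j.injective i, h, hj]
  exact placeAt_apply w' j' j'.injective i

end Monomials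

variable {A : Type*}

theorem wordAt_ne_zero (I : Sentence A) (i : Fin I.length) : wordAt I i ≠ 0 :=
  fun h => (I.get i).2 h

theorem consMonomial_placeAt_wordAt (w : NWord A) (I : Sentence A) (j : Fin I.length → ℕ) :
    consMonomial (FreeAddMonoid.ofList w.1) (placeAt (wordAt I) j) =
      placeAt (wordAt (w :: I)) (Fin.cons 0 fun i => j i + 1 : Fin (I.length + 1) → ℕ) := by
  rw [consMonomial_placeAt]
  congr 1
  funext i
  refine Fin.cases rfl (fun i => rfl) i

theorem exists_placeAt_consWord (w : Word A) (I : Sentence A) (j : Fin I.length ↪o ℕ) :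
    ∃ j' : Fin (consWord w I).length ↪o ℕ, placeAt (wordAt (consWord w I)) j' =
      consMonomial (FreeAddMonoid.ofList w) (placeAt (wordAt I) j) := by
  by_cases hw : w = []
  · subst hw
    refine ⟨OrderEmbedding.ofStrictMono (fun i => j i + 1) fun a b h =>
      Nat.succ_lt_succ (j.strictMono h), ?_⟩
    have := placeAt_succ (Fin.cons 0 (wordAt I) : Fin (I.length + 1) → FreeAddMonoid A)
      (Fin.cons 0 fun i => j i + 1)
    rw [FreeAddMonoid.ofList_nil, consMonomial_placeAt, this]
    simp
    rfl
  · rw [consWord_of_ne hw]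
    refine ⟨OrderEmbedding.ofStrictMono
      (Fin.cons 0 fun i => j i + 1 : Fin (I.length + 1) → ℕ) ?_,
      (consMonomial_placeAt_wordAt ⟨w, hw⟩ I j).symm⟩
    refine Fin.cases ?_ fun i => ?_
    · refine Fin.cases (fun h => absurd h (lt_irrefl _)) fun i _ => Nat.succ_pos _
    · refine Fin.cases (fun h => absurd h (Fin.not_lt_zero _)) fun i' h => ?_
      exact Nat.succ_lt_succ (j.strictMono (Fin.succ_lt_succ_iff.1 h))

/-- Every monomial is `x_{w₁,j₁} ⋯ x_{w_k,j_k}` for a sentence `(w₁, …, w_k)` and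
`j₁ < ⋯ < j_k`. -/
theorem exists_placeAt_eq (m : ColMonomial A) :
    ∃ (I : Sentence A) (j : Fin I.length ↪o ℕ), placeAt (wordAt I) j = m := by
  induction m using monomial_induction with
  | zero => exact ⟨[], Fin.valOrderEmb 0, rfl⟩
  | cons a p ih =>
    obtain ⟨I, j, rfl⟩ := ih
    exact ⟨_, exists_placeAt_consWord (FreeAddMonoid.toList a) I j⟩

/-- The sentence of the nonempty values of a monomial, in the order of their indices. -/
def flat (m : ColMonomial A) : Sentence A := (exists_placeAt_eq m).choose

theorem flat_placeAt (I : Sentence A) (j : Fin I.length ↪o ℕ) :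
    flat (placeAt (wordAt I) j) = I := by
  obtain ⟨j', h⟩ := (exists_placeAt_eq (placeAt (wordAt I) j)).choose_spec
  obtain ⟨e, h1, -⟩ := placeAt_unique _ _ (wordAt_ne_zero _) (wordAt_ne_zero _) j' j h
  exact List.ext_get e fun n h2 h3 => Subtype.ext (h1 ⟨n, h2⟩)

theorem flat_stdMonomial (I : Sentence A) : flat (stdMonomial I) = I :=
  flat_placeAt I (Fin.valOrderEmb _)

theorem flat_zero : flat (0 : ColMonomial A) = [] := flat_stdMonomial []

theorem flat_consMonomial (w : Word A) (p : ColMonomial A) :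
    flat (consMonomial (FreeAddMonoid.ofList w) p) = consWord w (flat p) := by
  obtain ⟨I, j, rfl⟩ := exists_placeAt_eq p
  obtain ⟨j', hj'⟩ := exists_placeAt_consWord w I j
  rw [flat_placeAt, ← hj', flat_placeAt]

/-- The coefficient of a monomial in `M_I` depends on its sentence only. -/
theorem M_apply [DecidableEq A] (I : Sentence A) (m : ColMonomial A) :
    M I m = if flat m = I then 1 else 0 := by
  unfold M formalSum
  split_ifs with h
  · subst h
    obtain ⟨j, hj⟩ := (exists_placeAt_eq m).choose_spec
    rw [Nat.cast_eq_one, Nat.card_eq_one_iff_unique]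
    refine ⟨⟨fun a b => Subtype.ext (RelEmbedding.ext fun i => ?_)⟩, ⟨⟨j, hj⟩⟩⟩
    obtain ⟨_, _, h⟩ := placeAt_unique _ _ (wordAt_ne_zero _) (wordAt_ne_zero _) a.1 b.1
      (a.2.trans b.2.symm)
    exact h i
  · have : IsEmpty {j : Fin I.length ↪o ℕ // placeAt (wordAt I) j = m} :=
      ⟨fun a => h (by rw [← a.2, flat_placeAt])⟩
    simp

/-! ### Sums over the factorizations of a monomial -/

section ProdSum

variable {X : Type*} [AddCommMonoid X]

/-- The factorizations of a monomial, one variable at a time. -/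
def factorizationEquiv (w : Word A) (m : ColMonomial A) :
    {p : Word A × Word A // p.1 ++ p.2 = w} × {p : ColMonomial A × ColMonomial A // p.1 + p.2 = m} ≃
      {p : ColMonomial A × ColMonomial A //
        p.1 + p.2 = consMonomial (FreeAddMonoid.ofList w) m} :=
  Equiv.ofBijective
    (fun x => ⟨(consMonomial (FreeAddMonoid.ofList x.1.1.1) x.2.1.1,
      consMonomial (FreeAddMonoid.ofList x.1.1.2) x.2.1.2), by
        rw [consMonomial_add, ← FreeAddMonoid.ofList_append, x.1.2, x.2.2]⟩) <| by
    constructor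
    · rintro ⟨⟨⟨a, b⟩, hab⟩, ⟨⟨p, q⟩, hpq⟩⟩ ⟨⟨⟨a', b'⟩, hab'⟩, ⟨⟨p', q'⟩, hpq'⟩⟩ h
      simpa [consMonomial_inj, and_and_and_comm] using h
    · rintro ⟨⟨p, q⟩, h⟩
      obtain ⟨a, p, rfl⟩ := exists_eq_consMonomial p
      obtain ⟨b, q, rfl⟩ := exists_eq_consMonomial q
      simp only [consMonomial_add, consMonomial_inj] at h
      exact ⟨⟨⟨(FreeAddMonoid.toList a, FreeAddMonoid.toList b), h.1⟩, ⟨(p, q), h.2⟩⟩, rfl⟩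

theorem eq_zero_of_add_eq_zero {p q : ColMonomial A} (h : p + q = 0) : p = 0 ∧ q = 0 := by
  have h1 : ∀ n, p n = 0 ∧ q n = 0 := fun n =>
    List.append_eq_nil_iff.1 (DFunLike.congr_fun h n : p n + q n = 0)
  exact ⟨Finsupp.ext fun n => (h1 n).1, Finsupp.ext fun n => (h1 n).2⟩

/-- The monomial `1` has only the trivial factorization. -/
instance : Unique {p : ColMonomial A × ColMonomial A // p.1 + p.2 = 0} where
  default := ⟨(0, 0), add_zero 0⟩
  uniq p := Subtype.ext <| Prod.ext (eq_zero_of_add_eq_zero p.2).1 (eq_zero_of_add_eq_zero p.2).2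

instance (w : Word A) : Finite {p : Word A × Word A // p.1 ++ p.2 = w} := by
  classical
  exact Set.Finite.to_subtype ((wordSplits w).toFinset.finite_toSet.subset fun p hp => by
    simpa using mem_wordSplits.2 hp)

instance finite_factorizations (m : ColMonomial A) :
    Finite {p : ColMonomial A × ColMonomial A // p.1 + p.2 = m} := by
  induction m using monomial_induction with
  | zero => infer_instance
  | cons a p ih => exact Finite.of_equiv _ (factorizationEquiv (FreeAddMonoid.toList a) p)

/-- The sum of `Φ p q` over the factorizations `m = p q` of a monomial. -/
def prodSum (m : ColMonomial A) (Φ : ColMonomial A → ColMonomial A → X) : X :=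
  ∑ᶠ p : {p : ColMonomial A × ColMonomial A // p.1 + p.2 = m}, Φ p.1.1 p.1.2

theorem finsum_append_eq (w : Word A) (F : Word A → Word A → X) :
    ∑ᶠ p : {p : Word A × Word A // p.1 ++ p.2 = w}, F p.1.1 p.1.2 = wordSplitSum w F := by
  classical
  rw [finsum_subtype_eq_finsum_cond (f := fun p : Word A × Word A => F p.1 p.2)
    (fun p : Word A × Word A => p.1 ++ p.2 = w)]
  simp only [← mem_wordSplits, ← List.mem_toFinset]
  rw [finsum_mem_finset_eq_sum, List.sum_toFinset _ (nodup_wordSplits w), wordSplitSum]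

theorem prodSum_zero (Φ : ColMonomial A → ColMonomial A → X) :
    prodSum 0 Φ = Φ 0 0 := finsum_unique _

theorem prodSum_consMonomial (w : Word A) (m : ColMonomial A)
    (Φ : ColMonomial A → ColMonomial A → X) :
    prodSum (consMonomial (FreeAddMonoid.ofList w) m) Φ = wordSplitSum w fun a b => prodSum m
      fun p q => Φ (consMonomial (FreeAddMonoid.ofList a) p)
        (consMonomial (FreeAddMonoid.ofList b) q) := by
  rw [prodSum, ← finsum_comp_equiv (factorizationEquiv w m), finsum_curry _ (Set.toFinite _),
    ← finsum_append_eq]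
  rfl

/-- Summing a function of the sentences of the factors amounts to summing over the splittings of
the sentence of the monomial. -/
theorem prodSum_flat (m : ColMonomial A) (φ : Sentence A → Sentence A → X) :
    (prodSum m fun p q => φ (flat p) (flat q)) = splitSum (flat m) φ := by
  induction m using monomial_induction generalizing φ with
  | zero => rw [prodSum_zero, flat_zero, splitSum_nil]
  | cons a m ih =>
    obtain ⟨w, rfl⟩ := FreeAddMonoid.ofList.surjective a
    simp only [prodSum_consMonomial, flat_consMonomial, splitSum_consWord, ← ih]

end ProdSum

theorem mul_apply (F G : ColSeries A) (m : ColMonomial A) :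
    (F * G) m = prodSum m fun p q => F p * G q := rfl

theorem M_mul_M_apply [DecidableEq A] (I S : Sentence A) (m : ColMonomial A) :
    (M I * M S) m = splitSum (flat m) fun I' S' => (if I' = I then 1 else 0) *
      (if S' = S then 1 else 0) := by
  rw [mul_apply, ← prodSum_flat]
  simp only [M_apply]

/-! ### The Bernstein operators on the basis `H` -/

/-- A locally finite sum of linear maps can be computed on a basis. -/
theorem finsum_eq_of_basis {ι κ V V' : Type*} [AddCommGroup V] [Module ℚ V] [AddCommGroup V']
    [Module ℚ V'] (b : Module.Basis κ ℚ V) (L : ι → V →ₗ[ℚ] V') (B : V →ₗ[ℚ] V')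
    (h : ∀ k, (Function.support fun i => L i (b k)).Finite ∧ ∑ᶠ i, L i (b k) = B (b k)) (f : V) :
    (Function.support fun i => L i f).Finite ∧ ∑ᶠ i, L i f = B f := by
  induction b.mem_span f using Submodule.span_induction with
  | mem x hx =>
    obtain ⟨k, rfl⟩ := hx
    exact h k
  | zero => simp
  | add x y _ _ hx hy =>
    simp only [map_add]
    refine ⟨(hx.1.union hy.1).subset (Function.support_add _ _), ?_⟩
    rw [finsum_add_distrib hx.1 hy.1, hx.2, hy.2]
  | smul c x _ hx =>
    simp only [map_smul]
    refine ⟨hx.1.subset (Function.support_const_smul_subset c _), ?_⟩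
    rw [← smul_finsum' c hx.1, hx.2]

variable (A) in
/-- The complete homogeneous basis of `NSym_A`. -/
def hBasis : Module.Basis (Sentence A) ℚ (NSymA A) :=
  (MonoidAlgebra.basis (FreeMonoid (NWord A)) ℚ).reindex FreeMonoid.toList

@[simp] theorem hBasis_apply (I : Sentence A) : hBasis A I = H I := by
  simp [hBasis, H, MonoidAlgebra.of_apply]

theorem pairing_H (I : Sentence A) (F : ColSeries A) : pairing (H I) F = F (stdMonomial I) := by
  simp [pairing, H, MonoidAlgebra.of_apply, ColSeries.coeff]

theorem H_nil : H ([] : Sentence A) = 1 := map_one (MonoidAlgebra.of ℚ (FreeMonoid (NWord A)))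

theorem H_mul_H (I J : Sentence A) : H I * H J = H (I ++ J) := by
  rw [H, H, H, FreeMonoid.ofList_append, map_mul]

theorem Hword_mul_H (w : Word A) (I : Sentence A) : Hword w * H I = H (consWord w I) := by
  rw [Hword]
  split_ifs with h
  · subst h
    rw [one_mul, consWord_nil]
  · rw [H_mul_H, consWord_of_ne h]
    rfl

/-- The linear operator on `NSym_A` with `H_K ↦ ∑ φ I S`, the sum running over the splittings
`(I, S)` of `K`. -/
def splitOp {X : Type*} [AddCommGroup X] [Module ℚ X] (φ : Sentence A → Sentence A → X) :
    NSymA A →ₗ[ℚ] X :=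
  (hBasis A).constr ℚ fun K => splitSum K φ

theorem splitOp_H {X : Type*} [AddCommGroup X] [Module ℚ X] (φ : Sentence A → Sentence A → X)
    (K : Sentence A) : splitOp φ (H K) = splitSum K φ := by
  rw [← hBasis_apply, splitOp, Module.Basis.constr_basis]

theorem splitOp_zero {X : Type*} [AddCommGroup X] [Module ℚ X] (f : NSymA A) :
    splitOp (fun _ _ => (0 : X)) f = 0 := by
  have : splitOp (fun _ _ => (0 : X)) = (0 : NSymA A →ₗ[ℚ] X) := by
    refine (hBasis A).ext fun K => ?_
    simp [splitOp_H, splitSum_zero]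
  rw [this, LinearMap.zero_apply]

theorem finsum_splitOp {β X : Type*} [AddCommGroup X] [Module ℚ X]
    (φ : β → Sentence A → Sentence A → X) (ψ : Sentence A → Sentence A → X)
    (h : ∀ I S, (Function.support fun i => φ i I S).Finite ∧ ∑ᶠ i, φ i I S = ψ I S)
    (f : NSymA A) : (Function.support fun i => splitOp (φ i) f).Finite ∧
      ∑ᶠ i, splitOp (φ i) f = splitOp ψ f := by
  refine finsum_eq_of_basis (hBasis A) _ _ (fun K => ?_) f
  simp only [hBasis_apply, splitOp_H]
  have := finsum_splitSum K φ fun I S => (h I S).1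
  exact ⟨this.1, this.2.trans (splitSum_congr fun I S _ => (h I S).2)⟩

theorem map_splitOp {X Y : Type*} [AddCommGroup X] [Module ℚ X] [AddCommGroup Y] [Module ℚ Y]
    (g : X →ₗ[ℚ] Y) (φ : Sentence A → Sentence A → X) (f : NSymA A) :
    g (splitOp φ f) = splitOp (fun I S => g (φ I S)) f := by
  have : g ∘ₗ splitOp φ = splitOp fun I S => g (φ I S) := by
    refine (hBasis A).ext fun K => ?_
    simp [splitOp_H, map_splitSum]
  exact LinearMap.congr_fun this f

theorem finsum_coeff_smul_H (f : NSymA A) :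
    (Function.support fun I : Sentence A => (hBasis A).repr f I • H I).Finite ∧
      ∑ᶠ I : Sentence A, (hBasis A).repr f I • H I = f := by
  have hs : (Function.support fun I : Sentence A => (hBasis A).repr f I • H I) ⊆
      (((hBasis A).repr f).support : Set (Sentence A)) := by
    intro I hI
    by_contra hn
    exact hI (by simp [Finsupp.notMem_support_iff.1 hn])
  refine ⟨(Finset.finite_toSet _).subset hs, ?_⟩
  rw [finsum_eq_sum_of_support_subset _ hs]
  conv_rhs => rw [← (hBasis A).linearCombination_repr f, Finsupp.linearCombination_apply]
  simp [Finsupp.sum]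

open Classical in
/-- The coefficients of `M_S^⫫ f` are the pairings that define it. -/
theorem repr_splitOp (S : Sentence A) (f : NSymA A) (I : Sentence A) :
    (hBasis A).repr (splitOp (fun I' S' => if S' = S then H I' else 0) f) I =
      pairing f (M I * M S) := by
  have : (hBasis A).coord I ∘ₗ splitOp (fun I' S' => if S' = S then H I' else 0) =
      pairing.flip (M I * M S) := by
    refine (hBasis A).ext fun K => ?_
    simp only [hBasis_apply, LinearMap.comp_apply, splitOp_H, map_splitSum, LinearMap.flip_apply,
      pairing_H, M_mul_M_apply, flat_stdMonomial]
    refine splitSum_congr fun I' S' _ => ?_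
    rw [Module.Basis.coord_apply, ← hBasis_apply]
    by_cases hS : S' = S
    · simp [hS, -hBasis_apply, Finsupp.single_apply]
    · simp [hS]
  exact LinearMap.congr_fun this f

open Classical in
theorem rperp_M (S : Sentence A) (f : NSymA A) :
    rperp (M S) f = splitOp (fun I' S' => if S' = S then H I' else 0) f := by
  rw [rperp]
  simp only [← repr_splitOp]
  exact (finsum_coeff_smul_H _).2

open Classical in
theorem finsum_rperp_M (Q : Sentence A) (f : NSymA A) :
    ∑ᶠ (S : Sentence A) (_ : Sentence.Refines Q S), rperp (M S) f =
      splitOp (fun I S => if Sentence.Refines Q S then H I else 0) f := by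
  have h1 : ∀ S : Sentence A, (∑ᶠ (_ : Sentence.Refines Q S), rperp (M S) f) =
      splitOp (fun I' S' => if S' = S ∧ Sentence.Refines Q S then H I' else 0) f := by
    intro S
    rw [finsum_eq_if, rperp_M]
    split_ifs with h
    · simp [h]
    · simp only [h, and_false, if_false]
      exact (splitOp_zero f).symm
  simp only [h1]
  refine (finsum_splitOp _ _ (fun I S' => ?_) f).2
  have hs : (Function.support fun S => if S' = S ∧ Sentence.Refines Q S then H I else 0) ⊆
      ({S'} : Set (Sentence A)) := by
    intro S hS
    by_contra hn
    exact hS (if_neg fun h => hn h.1.symm)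
  refine ⟨(Set.finite_singleton _).subset hs, ?_⟩
  rw [finsum_eq_single _ S' fun S hS => if_neg fun h => hS h.1.symm]
  simp

/-- The Bernstein operator on the basis `H`. -/
theorem bernsteinA_eq (v : Word A) (f : NSymA A) : bernsteinA v f =
    splitOp (fun I S => altRefSum S fun Q => H (consWord (v ++ maxWord Q.reverse) I)) f := by
  classical
  rw [bernsteinA]
  simp only [finsum_rperp_M]
  have h1 : ∀ Q : Sentence A, (-1 : ℚ) ^ Q.length • (Hword (v ++ maxWord Q.reverse) *
      splitOp (fun I S => if Sentence.Refines Q S then H I else 0) f) =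
      splitOp (fun I S => (-1 : ℚ) ^ Q.length • if Sentence.Refines Q S then
        H (consWord (v ++ maxWord Q.reverse) I) else 0) f := by
    intro Q
    have := map_splitOp ((-1 : ℚ) ^ Q.length • LinearMap.mulLeft ℚ (Hword (v ++ maxWord Q.reverse)))
      (fun I S => if Sentence.Refines Q S then H I else 0) f
    simpa [mul_ite, Hword_mul_H] using this
  simp only [h1]
  refine (finsum_splitOp _ _ (fun I S => ?_) f).2
  exact finsum_refines S fun Q => H (consWord (v ++ maxWord Q.reverse) I)

/-! ### Rows of tableaux -/

/-- The product, from left to right, of the variables of a row with colors `u` and entries `r`. -/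
def rowMonomial (u : Word A) (r : Fin u.length → ℕ) : ColMonomial A :=
  ((List.finRange u.length).map fun j =>
    Finsupp.single (r j) (FreeAddMonoid.of (u.get j))).sum

theorem sum_single_apply {ι : Type*} (l : List ι) (r : ι → ℕ) (g : ι → A) (k : ℕ) :
    (l.map fun j => Finsupp.single (r j) (FreeAddMonoid.of (g j))).sum k =
      FreeAddMonoid.ofList ((l.filter fun j => r j = k).map g) := by
  induction l with
  | nil => simp
  | cons a l ih =>
    rw [List.map_cons, List.sum_cons, Finsupp.add_apply, ih, List.filter_cons]
    by_cases h : r a = k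
    · simp [h]
    · simp [h, Finsupp.single_eq_of_ne' h]

theorem rowMonomial_apply (u : Word A) (r : Fin u.length → ℕ) (k : ℕ) :
    rowMonomial u r k = FreeAddMonoid.ofList
      (((List.finRange u.length).filter fun j => r j = k).map u.get) :=
  sum_single_apply _ _ _ _

theorem rowMonomial_apply_ne_zero {u : Word A} {r : Fin u.length → ℕ} {k : ℕ} :
    rowMonomial u r k ≠ 0 ↔ ∃ j, r j = k := by
  have : rowMonomial u r k = 0 ↔
      ((List.finRange u.length).filter fun j => r j = k).map u.get = [] := by
    rw [rowMonomial_apply]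
    exact Iff.rfl
  rw [Ne, this]
  simp

theorem rowMonomial_cons (x : A) (u : Word A) (r : Fin (x :: u).length → ℕ) :
    rowMonomial (x :: u) r = Finsupp.single (r ⟨0, Nat.succ_pos _⟩) (FreeAddMonoid.of x) +
      rowMonomial u fun j => r j.succ := by
  simp only [rowMonomial, List.length_cons, List.finRange_succ, List.map_cons, List.sum_cons,
    List.map_map, Function.comp_def]
  rfl

theorem eq_zero_of_flat_eq_nil {m : ColMonomial A} (h : flat m = []) : m = 0 := by
  obtain ⟨I, j, rfl⟩ := exists_placeAt_eq m
  rw [flat_placeAt] at h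
  subst h
  rfl

/-- Multiplying on the left by a variable whose index is at most those occurring in `q` adds a
letter in front of the concatenated values. -/
theorem maxWord_flat_single_add (x : A) (k : ℕ) (q : ColMonomial A) (hq : ∀ n < k, q n = 0) :
    maxWord (flat (Finsupp.single k (FreeAddMonoid.of x) + q)) = x :: maxWord (flat q) := by
  induction k generalizing q with
  | zero =>
    obtain ⟨a, p, rfl⟩ := exists_eq_consMonomial q
    obtain ⟨w, rfl⟩ := FreeAddMonoid.ofList.surjective a
    rw [← consMonomial_zero_right, consMonomial_add, zero_add, flat_consMonomial,
      ← FreeAddMonoid.ofList_singleton, ← FreeAddMonoid.ofList_append, flat_consMonomial]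
    simp
  | succ k ih =>
    obtain ⟨a, p, rfl⟩ := exists_eq_consMonomial q
    obtain rfl : a = 0 := by simpa using hq 0 (Nat.succ_pos k)
    rw [← consMonomial_zero_single, consMonomial_add, zero_add, ← FreeAddMonoid.ofList_nil,
      flat_consMonomial, flat_consMonomial, consWord_nil, consWord_nil]
    exact ih p fun n hn => by simpa using hq (n + 1) (by omega)

theorem exists_eq_single_add {x : A} {u : Word A} {p : ColMonomial A}
    (h : maxWord (flat p) = x :: u) : ∃ k q, p = Finsupp.single k (FreeAddMonoid.of x) + q ∧
      (∀ n < k, q n = 0) ∧ maxWord (flat q) = u := by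
  induction p using monomial_induction with
  | zero => simp [flat_zero] at h
  | cons a p ih =>
    obtain ⟨w, rfl⟩ := FreeAddMonoid.ofList.surjective a
    rw [flat_consMonomial, maxWord_consWord] at h
    cases w with
    | nil =>
      obtain ⟨k, q, rfl, h2, h3⟩ := ih h
      refine ⟨k + 1, consMonomial 0 q, ?_, ?_, ?_⟩
      · rw [← consMonomial_zero_single, consMonomial_add]
        simp
      · intro n hn
        cases n with
        | zero => simp
        | succ n => simpa using h2 n (by omega)
      · rw [← FreeAddMonoid.ofList_nil, flat_consMonomial]
        simpa using h3
    | cons y w =>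
      simp only [List.cons_append, List.cons.injEq] at h
      obtain ⟨rfl, h⟩ := h
      refine ⟨0, consMonomial (FreeAddMonoid.ofList w) p, ?_, by simp, ?_⟩
      · rw [← consMonomial_zero_right, consMonomial_add, zero_add]
        rfl
      · rw [flat_consMonomial, maxWord_consWord, h]

theorem maxWord_flat_rowMonomial {u : Word A} {r : Fin u.length → ℕ} (hr : Monotone r) :
    maxWord (flat (rowMonomial u r)) = u := by
  induction u with
  | nil => simp [rowMonomial, flat_zero]
  | cons x u ih =>
    rw [rowMonomial_cons, maxWord_flat_single_add, ih]
    · exact fun i j h => hr (Fin.succ_le_succ_iff.2 h)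
    · intro n hn
      by_contra h
      obtain ⟨j, rfl⟩ := rowMonomial_apply_ne_zero.1 h
      exact absurd (hr (Fin.zero_le j.succ)) (not_le.2 hn)

theorem rowMonomial_injective {u : Word A} {r r' : Fin u.length → ℕ} (hr : Monotone r)
    (hr' : Monotone r') (h : rowMonomial u r = rowMonomial u r') : r = r' := by
  induction u with
  | nil => exact funext fun j => j.elim0
  | cons x u ih =>
    -- The first entry of a weakly increasing row is the least index in its monomial.
    have key : ∀ {r r' : Fin (x :: u).length → ℕ}, Monotone r' →
        rowMonomial (x :: u) r = rowMonomial (x :: u) r' →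
        r' ⟨0, Nat.succ_pos _⟩ ≤ r ⟨0, Nat.succ_pos _⟩ := by
      intro r r' hr' h
      obtain ⟨j, hj⟩ := rowMonomial_apply_ne_zero.1
        (h ▸ rowMonomial_apply_ne_zero.2 ⟨⟨0, Nat.succ_pos _⟩, rfl⟩ :
          rowMonomial (x :: u) r' (r ⟨0, Nat.succ_pos _⟩) ≠ 0)
      exact hj ▸ hr' (Fin.zero_le j)
    have h0 := (key hr h.symm).antisymm (key hr' h)
    rw [rowMonomial_cons, rowMonomial_cons, h0] at h
    have hs := ih (fun i j h => hr (Fin.succ_le_succ_iff.2 h))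
      (fun i j h => hr' (Fin.succ_le_succ_iff.2 h)) (add_left_cancel h)
    funext j
    exact Fin.cases h0 (fun j => congrFun hs j) j

theorem exists_rowMonomial_eq {u : Word A} {p : ColMonomial A} (h : maxWord (flat p) = u) :
    ∃ r : Fin u.length → ℕ, Monotone r ∧ rowMonomial u r = p := by
  induction u generalizing p with
  | nil =>
    obtain rfl := eq_zero_of_flat_eq_nil (maxWord_eq_nil h)
    exact ⟨fun j => j.elim0, fun j => j.elim0, by simp [rowMonomial]⟩
  | cons x u ih =>
    obtain ⟨k, q, rfl, hq, hu⟩ := exists_eq_single_add h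
    obtain ⟨r, hr, rfl⟩ := ih hu
    refine ⟨(Fin.cons k r : Fin (u.length + 1) → ℕ), ?_, ?_⟩
    · refine Fin.cases (fun j _ => ?_) fun i => ?_
      · refine Fin.cases le_rfl (fun j => ?_) j
        by_contra hn
        exact rowMonomial_apply_ne_zero.2 ⟨j, rfl⟩ (hq (r j) (not_le.1 hn))
      · refine Fin.cases (fun h => absurd h (by simp)) fun j h => ?_
        exact hr (Fin.succ_le_succ_iff.1 h)
    · rw [rowMonomial_cons]
      rfl

/-- A weakly increasing row with colors `u` is determined by its monomial, which can be any
monomial whose values concatenate to `u`. -/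
theorem card_rows [DecidableEq A] (u : Word A) (p : ColMonomial A) :
    Nat.card {r : Fin u.length → ℕ // Monotone r ∧ rowMonomial u r = p} =
      if maxWord (flat p) = u then 1 else 0 := by
  split_ifs with h
  · obtain ⟨r, hr⟩ := exists_rowMonomial_eq h
    rw [Nat.card_eq_one_iff_unique]
    exact ⟨⟨fun a b => Subtype.ext (rowMonomial_injective a.2.1 b.2.1 (a.2.2.trans b.2.2.symm))⟩,
      ⟨⟨r, hr⟩⟩⟩
  · have : IsEmpty {r : Fin u.length → ℕ // Monotone r ∧ rowMonomial u r = p} :=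
      ⟨fun a => h (by rw [← a.2.2, maxWord_flat_rowMonomial a.2.1])⟩
    exact Nat.card_of_isEmpty

instance finite_rows (u : Word A) (p : ColMonomial A) :
    Finite {r : Fin u.length → ℕ // Monotone r ∧ rowMonomial u r = p} :=
  @Finite.of_subsingleton _
    ⟨fun a b => Subtype.ext (rowMonomial_injective a.2.1 b.2.1 (a.2.2.trans b.2.2.symm))⟩

/-! ### Counting tableaux -/

namespace CIT

variable {J : Sentence A} {u : NWord A}

theorem ext_entry {T T' : CIT J} (h : ∀ i j, T.entry i j = T'.entry i j) : T = T' := by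
  cases T
  cases T'
  congr
  funext i j
  exact h i j

theorem monomial_apply (T : CIT J) (k : ℕ) :
    T.monomial k = FreeAddMonoid.ofList (T.typeWord k) := rfl

theorem monomial_apply_ne_zero {T : CIT J} {k : ℕ} :
    T.monomial k ≠ 0 ↔ ∃ i j, T.entry i j = k := by
  have : T.monomial k = 0 ↔ T.typeWord k = [] := Iff.rfl
  rw [Ne, this, typeWord]
  simp

/-- The tableau without its first row. -/
def tail (T : CIT (u :: J)) : CIT J where
  entry i j := T.entry i.succ j
  row_weak i := T.row_weak i.succ
  col_strict i i' h := T.col_strict i.succ i'.succ (Fin.succ_lt_succ_iff.2 h)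

/-- The first row of a tableau. -/
def head (T : CIT (u :: J)) : Fin u.1.length → ℕ := T.entry ⟨0, Nat.succ_pos _⟩

theorem monotone_head (T : CIT (u :: J)) : Monotone T.head := T.row_weak _

/-- The tableau with a given first row. -/
def cons (r : Fin u.1.length → ℕ) (T : CIT J) (hr : Monotone r)
    (h : ∀ i, r ⟨0, List.length_pos_iff.2 u.2⟩ <
      T.entry i ⟨0, List.length_pos_iff.2 (J.get i).2⟩) : CIT (u :: J) where
  entry i := Fin.cases (motive := fun i : Fin (J.length + 1) =>
    Fin ((u :: J).get i).1.length → ℕ) r (fun i => T.entry i) i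
  row_weak i := by
    refine Fin.cases (motive := fun i : Fin (J.length + 1) => Monotone (Fin.cases
      (motive := fun i : Fin (J.length + 1) => Fin ((u :: J).get i).1.length → ℕ) r
      (fun i => T.entry i) i)) ?_ (fun i => ?_) i
    · exact hr
    · exact T.row_weak i
  col_strict i i' := by
    refine Fin.cases (fun h => absurd h (Fin.not_lt_zero _)) (fun i' => ?_) i'
    refine Fin.cases (fun _ => ?_) (fun i hi => ?_) i
    · exact h i'
    · exact T.col_strict i i' (Fin.succ_lt_succ_iff.1 hi)

theorem eq_of_head_tail {T T' : CIT (u :: J)} (h : T.head = T'.head) (ht : T.tail = T'.tail) :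
    T = T' := by
  refine ext_entry fun i => ?_
  refine Fin.cases (fun j => congrFun h j) (fun i j => ?_) i
  exact congrFun (congrFun (congrArg entry ht) i) j

theorem monomial_eq (T : CIT (u :: J)) :
    T.monomial = T.tail.monomial + rowMonomial u.1 T.head := by
  ext k
  rw [Finsupp.add_apply, rowMonomial_apply, monomial_apply, monomial_apply,
    ← FreeAddMonoid.ofList_append]
  congr 1
  simp only [typeWord, List.length_cons, List.finRange_succ, List.reverse_cons,
    List.flatMap_append, ← List.map_reverse, List.flatMap_map, List.flatMap_singleton]
  rfl

/-- The tableau with all entries increased by one. -/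
def shift (T : CIT J) : CIT J where
  entry i j := T.entry i j + 1
  row_weak i _ _ h := Nat.succ_le_succ (T.row_weak i h)
  col_strict i i' h := Nat.succ_lt_succ (T.col_strict i i' h)

theorem monomial_shift (T : CIT J) : T.shift.monomial = consMonomial 0 T.monomial := by
  refine eq_consMonomial_iff.2 ⟨?_, fun n => ?_⟩
  · by_contra h
    obtain ⟨i, j, hij⟩ := monomial_apply_ne_zero.1 h
    exact Nat.succ_ne_zero _ hij
  · simp [monomial_apply, typeWord, shift]

theorem exists_shift_eq {T : CIT J} (h : T.monomial 0 = 0) : ∃ T' : CIT J, T'.shift = T := by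
  have hpos : ∀ i j, T.entry i j - 1 + 1 = T.entry i j := fun i j =>
    Nat.sub_add_cancel (Nat.one_le_iff_ne_zero.2 fun h0 => monomial_apply_ne_zero.2 ⟨i, j, h0⟩ h)
  refine ⟨⟨fun i j => T.entry i j - 1, fun i a b hab => ?_, fun i i' hi => ?_⟩,
    ext_entry fun i j => hpos i j⟩
  · exact Nat.sub_le_sub_right (T.row_weak i hab) 1
  · have h1 := T.col_strict i i' hi
    rw [← hpos i, ← hpos i'] at h1
    exact Nat.lt_of_succ_lt_succ h1

instance finite_fiber (m : ColMonomial A) : Finite {T : CIT J // T.monomial = m} := by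
  refine Finite.of_injective (β := (i : Fin J.length) → Fin (J.get i).1.length → m.support)
    (fun T i j => ⟨T.1.entry i j, Finsupp.mem_support_iff.2
      (DFunLike.congr_fun T.2 _ ▸ monomial_apply_ne_zero.2 ⟨i, j, rfl⟩)⟩) fun T T' h => Subtype.ext (ext_entry fun i j => ?_)
  exact congrArg Subtype.val (congrFun (congrFun h i) j)

theorem card_fiber_shift (m : ColMonomial A) :
    Nat.card {T : CIT J // T.monomial = consMonomial 0 m} =
      Nat.card {T : CIT J // T.monomial = m} := by
  refine (Nat.card_congr (Equiv.ofBijective (fun T : {T : CIT J // T.monomial = m} =>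
    (⟨T.1.shift, by rw [monomial_shift, T.2]⟩ : {T : CIT J // T.monomial = consMonomial 0 m}))
    ⟨fun T T' h => ?_, fun T => ?_⟩)).symm
  · refine Subtype.ext (ext_entry fun i j => Nat.succ_injective ?_)
    exact congrFun (congrFun (congrArg (fun T => T.1.entry) h) i) j
  · obtain ⟨T', hT'⟩ := exists_shift_eq (T := T.1) (by rw [T.2]; simp)
    refine ⟨⟨T', ?_⟩, Subtype.ext hT'⟩
    have := T.2
    rw [← hT', monomial_shift] at this
    exact (consMonomial_inj.1 this).2

/-- A row containing the entry `0` can be put on top of any tableau not containing it. -/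
theorem head_zero_lt_of_monomial {w : Word A} (hw : w ≠ []) {p q : ColMonomial A}
    {r : Fin u.1.length → ℕ} (hr : Monotone r)
    (hp : rowMonomial u.1 r = consMonomial (FreeAddMonoid.ofList w) p)
    {T : CIT J} (hT : T.monomial = consMonomial 0 q) (i : Fin J.length) :
    r ⟨0, List.length_pos_iff.2 u.2⟩ < T.entry i ⟨0, List.length_pos_iff.2 (J.get i).2⟩ := by
  obtain ⟨j, hj⟩ := rowMonomial_apply_ne_zero.1 (show rowMonomial u.1 r 0 ≠ 0 by
    rw [hp, consMonomial_zero]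
    exact hw)
  have h0 : r ⟨0, List.length_pos_iff.2 u.2⟩ ≤ 0 :=
    (hr (Fin.mk_le_of_le_val (Nat.zero_le j.1))).trans hj.le
  refine lt_of_le_of_lt h0 (Nat.pos_of_ne_zero fun h => ?_)
  exact monomial_apply_ne_zero.2 ⟨i, _, h⟩ (by rw [hT, consMonomial_zero])

/-- The entry `0` can occur in the first row only. -/
theorem tail_monomial_zero (T : CIT (u :: J)) : T.tail.monomial 0 = 0 := by
  by_contra hn
  obtain ⟨i, j, hij⟩ := monomial_apply_ne_zero.1 hn
  have h1 := T.tail.row_weak i (Fin.mk_le_of_le_val (Nat.zero_le j.1) :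
    ⟨0, List.length_pos_iff.2 (J.get i).2⟩ ≤ j)
  have h2 := T.col_strict ⟨0, Nat.succ_pos _⟩ i.succ (Fin.succ_pos i)
  exact absurd (h2.trans_le (h1.trans hij.le)) (Nat.not_lt_zero _)

/-- Removing the boxes with the smallest entry, which fill a nonempty prefix `w` of the first row,
leaves a tableau on the other rows and a row unrelated to it. -/
theorem card_fiber_consMonomial [DecidableEq A] {w : Word A} (hw : w ≠ []) (m : ColMonomial A) :
    Nat.card {T : CIT (u :: J) // T.monomial = consMonomial (FreeAddMonoid.ofList w) m} =
      prodSum m fun q p => if w ++ maxWord (flat p) = u.1 then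
        Nat.card {T : CIT J // T.monomial = q} else 0 := by
  -- The index `x = (q, p)` records the monomials left after shifting: `q` of the rows below the
  -- first, `p` of the first row without its boxes with entry `0`.
  let f : (Σ x : {x : ColMonomial A × ColMonomial A // x.1 + x.2 = m},
      {r : Fin u.1.length → ℕ // Monotone r ∧
        rowMonomial u.1 r = consMonomial (FreeAddMonoid.ofList w) x.1.2} ×
      {T : CIT J // T.monomial = consMonomial 0 x.1.1}) →
      {T : CIT (u :: J) // T.monomial = consMonomial (FreeAddMonoid.ofList w) m} :=
    fun y => ⟨cons y.2.1.1 y.2.2.1 y.2.1.2.1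
      (head_zero_lt_of_monomial hw y.2.1.2.1 y.2.1.2.2 y.2.2.2), by
        rw [monomial_eq]
        change y.2.2.1.monomial + rowMonomial u.1 y.2.1.1 = _
        rw [y.2.2.2, y.2.1.2.2, consMonomial_add, y.1.2, zero_add]⟩
  have hf : Function.Bijective f := by
    constructor
    · rintro ⟨⟨⟨q, p⟩, hx⟩, ⟨r, hr, hrp⟩, ⟨T, hT⟩⟩ ⟨⟨⟨q', p'⟩, hx'⟩, ⟨r', hr', hrp'⟩, ⟨T', hT'⟩⟩ h
      obtain rfl : r = r' := congrArg (fun T => T.1.head) h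
      obtain rfl : T = T' := congrArg (fun T => T.1.tail) h
      obtain rfl : p = p' := (consMonomial_inj.1 (hrp.symm.trans hrp')).2
      obtain rfl : q = q' := (consMonomial_inj.1 (hT.symm.trans hT')).2
      rfl
    · rintro ⟨T, hT⟩
      obtain ⟨b, q, hq⟩ := exists_eq_consMonomial T.tail.monomial
      obtain ⟨a, p, hp⟩ := exists_eq_consMonomial (rowMonomial u.1 T.head)
      have hb : b = 0 := by
        rw [← consMonomial_zero b q, ← hq]
        exact tail_monomial_zero T
      subst hb
      have h := hT
      rw [monomial_eq, hq, hp, consMonomial_add, consMonomial_inj, zero_add] at h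
      obtain ⟨rfl, h⟩ := h
      exact ⟨⟨⟨(q, p), h⟩, ⟨T.head, T.monotone_head, hp⟩, ⟨T.tail, hq⟩⟩,
        Subtype.ext (eq_of_head_tail rfl rfl)⟩
  have := Fintype.ofFinite {x : ColMonomial A × ColMonomial A // x.1 + x.2 = m}
  rw [← Nat.card_congr (Equiv.ofBijective f hf), Nat.card_sigma, prodSum,
    finsum_eq_sum_of_fintype]
  refine Finset.sum_congr rfl fun x _ => ?_
  rw [Nat.card_prod, card_rows, card_fiber_shift, flat_consMonomial, maxWord_consWord, ite_mul,
    one_mul, zero_mul]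

end CIT

open Classical in
/-- The number of tableaux of shape `J` whose type is the sentence `K`, by recursion on the first
row of the shape and the first word of the type. -/
def tabCount : Sentence A → Sentence A → ℕ
  | [], [] => 1
  | [], _ :: _ => 0
  | _ :: _, [] => 0
  | u :: J, w :: K => splitSum K fun I S => if w.1 ++ maxWord S = u.1 then tabCount J I else 0

/-- The coefficient of a monomial in `𝔖*_J` depends on its sentence only, and satisfies the recursion
defining `tabCount`. -/
theorem card_fiber (J : Sentence A) (m : ColMonomial A) :
    Nat.card {T : CIT J // T.monomial = m} = tabCount J (flat m) := by
  classical
  induction J generalizing m with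
  | nil =>
    have h0 : ∀ T : CIT ([] : Sentence A), T.monomial = 0 :=
      fun T => Finsupp.ext fun k => rfl
    cases h : flat m with
    | nil =>
      obtain rfl := eq_zero_of_flat_eq_nil h
      rw [tabCount, Nat.card_eq_one_iff_unique]
      exact ⟨⟨fun a b => Subtype.ext (CIT.ext_entry fun i => i.elim0)⟩,
        ⟨⟨⟨fun i => i.elim0, fun i => i.elim0, fun i => i.elim0⟩, h0 _⟩⟩⟩
    | cons w K =>
      have : IsEmpty {T : CIT ([] : Sentence A) // T.monomial = m} := by
        refine ⟨fun T => ?_⟩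
        rw [← T.2, h0, flat_zero] at h
        exact absurd h (by simp)
      rw [tabCount, Nat.card_of_isEmpty]
  | cons u J ih =>
    induction m using monomial_induction with
    | zero =>
      have : IsEmpty {T : CIT (u :: J) // T.monomial = 0} :=
        ⟨fun T => (CIT.monomial_apply_ne_zero (T := T.1)).2
          ⟨⟨0, Nat.succ_pos J.length⟩, ⟨0, List.length_pos_iff.2 u.2⟩, rfl⟩ (DFunLike.congr_fun T.2 _)⟩
      rw [flat_zero, tabCount, Nat.card_of_isEmpty]
    | cons a m ihm =>
      obtain ⟨w, rfl⟩ := FreeAddMonoid.ofList.surjective a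
      by_cases hw : w = []
      · subst hw
        rw [flat_consMonomial, consWord_nil, ← ihm, FreeAddMonoid.ofList_nil,
          CIT.card_fiber_shift]
      · rw [CIT.card_fiber_consMonomial hw, flat_consMonomial, consWord_of_ne hw, tabCount,
          ← prodSum_flat]
        simp only [ih]

theorem dualImmaculateA_apply (J : Sentence A) (m : ColMonomial A) :
    dualImmaculateA J m = (tabCount J (flat m) : ℚ) := by
  rw [← card_fiber]
  rfl

/-- The type of a tableau has as many letters as its shape. -/
theorem tabCount_eq_zero {J K : Sentence A} (h : (maxWord J).length ≠ (maxWord K).length) :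
    tabCount J K = 0 := by
  classical
  induction J generalizing K with
  | nil =>
    cases K with
    | nil => exact absurd rfl h
    | cons w K => rw [tabCount]
  | cons u J ih =>
    cases K with
    | nil => rw [tabCount]
    | cons w K =>
      rw [tabCount]
      refine (splitSum_congr fun I S hIS => ?_).trans (splitSum_zero K)
      split_ifs with hu
      · refine ih fun hJ => h ?_
        rw [maxWord_cons, maxWord_cons, ← hu]
        simp only [List.length_append]
        omega
      · rfl

/-! ### Duality of the immaculate functions -/

theorem altRefSum_splitSum {X : Type*} [AddCommGroup X] [Module ℚ X] (S I : Sentence A)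
    (F : Sentence A → Sentence A → Sentence A → X) :
    (altRefSum S fun Q => splitSum I (F Q)) =
      splitSum I fun I₁ I₂ => altRefSum S fun Q => F Q I₁ I₂ := by
  have h : ∀ Q : Sentence A, (-1 : ℚ) ^ Q.length • splitSum I (F Q) =
      splitSum I fun I₁ I₂ => (-1 : ℚ) ^ Q.length • F Q I₁ I₂ := fun Q =>
    map_splitSum ((-1 : ℚ) ^ Q.length • LinearMap.id : X →ₗ[ℚ] X) I (F Q)
  simp only [altRefSum, h]
  exact sum_map_sum_comm (refinements S) (splits I) fun Q p => (-1 : ℚ) ^ Q.length • F Q p.1 p.2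

theorem pairing_H_dualImmaculateA (K J : Sentence A) :
    pairing (H K) (dualImmaculateA J) = (tabCount J K : ℚ) := by
  rw [pairing_H, dualImmaculateA_apply, flat_stdMonomial]

theorem pairing_bernsteinA (v : NWord A) (f : NSymA A) (G : ColSeries A) :
    pairing (bernsteinA v.1 f) G = splitOp (fun I S => altRefSum S fun Q => pairing
      (H (⟨v.1 ++ maxWord Q.reverse, List.append_ne_nil_of_left_ne_nil v.2 _⟩ :: I)) G) f := by
  have h := map_splitOp (pairing.flip G)
    (fun I S => altRefSum S fun Q => H (consWord (v.1 ++ maxWord Q.reverse) I)) f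
  rw [← bernsteinA_eq] at h
  simp only [map_altRefSum] at h
  simpa only [LinearMap.flip_apply, consWord_of_ne (List.append_ne_nil_of_left_ne_nil v.2 _)]
    using h

theorem pairing_bernsteinA_nil (v : NWord A) (f : NSymA A) :
    pairing (bernsteinA v.1 f) (dualImmaculateA []) = 0 := by
  rw [pairing_bernsteinA, ← splitOp_zero (X := ℚ) f]
  simp [pairing_H_dualImmaculateA, tabCount, altRefSum]

/-- The adjoint of `𝔹_v` sends the dual immaculate function of `(u, J)` to that of `J` if `u = v`,
and to `0` otherwise. -/
theorem pairing_bernsteinA_cons [DecidableEq A] (v u : NWord A) (J : Sentence A) (f : NSymA A) :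
    pairing (bernsteinA v.1 f) (dualImmaculateA (u :: J)) =
      if v = u then pairing f (dualImmaculateA J) else 0 := by
  have key : splitOp (fun I S => altRefSum S fun Q => pairing
      (H (⟨v.1 ++ maxWord Q.reverse, List.append_ne_nil_of_left_ne_nil v.2 _⟩ :: I))
        (dualImmaculateA (u :: J))) =
      (if v = u then (1 : ℚ) else 0) • pairing.flip (dualImmaculateA J) := by
    refine (hBasis A).ext fun K => ?_
    have h : ∀ I Q : Sentence A, (tabCount (u :: J) (⟨v.1 ++ maxWord Q.reverse,
        List.append_ne_nil_of_left_ne_nil v.2 _⟩ :: I) : ℚ) = splitSum I fun I₁ I₂ =>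
          if v.1 ++ (maxWord Q.reverse ++ maxWord I₂) = u.1 then (tabCount J I₁ : ℚ) else 0 := by
      intro I Q
      rw [tabCount, ← Nat.coe_castAddMonoidHom, map_splitSum]
      refine splitSum_congr fun I₁ I₂ _ => ?_
      rw [List.append_assoc]
      split_ifs <;> simp
    simp only [hBasis_apply, splitOp_H, LinearMap.smul_apply, LinearMap.flip_apply,
      pairing_H_dualImmaculateA, h, altRefSum_splitSum]
    -- After reassociating, the inner sum is the antipode identity for the second component `R`.
    rw [splitSum_coassoc K fun I₁ I₂ S => altRefSum S fun Q =>
      if v.1 ++ (maxWord Q.reverse ++ maxWord I₂) = u.1 then (tabCount J I₁ : ℚ) else 0,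
      splitSum_eq_of_right_nil]
    · simp [Subtype.ext_iff]
    · intro I₁ R hR
      exact splitSum_altRefSum_eq_zero hR fun y =>
        if v.1 ++ y = u.1 then (tabCount J I₁ : ℚ) else 0
  rw [pairing_bernsteinA, key]
  split_ifs <;> simp

theorem pairing_immaculateA [DecidableEq A] (I J : Sentence A) :
    pairing (immaculateA I) (dualImmaculateA J) = if I = J then 1 else 0 := by
  induction I generalizing J with
  | nil =>
    rw [immaculateA, List.foldr_nil, ← H_nil, pairing_H_dualImmaculateA]
    cases J <;> simp [tabCount]
  | cons v I ih =>
    change pairing (bernsteinA v.1 (immaculateA I)) (dualImmaculateA J) = _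
    cases J with
    | nil => simp [pairing_bernsteinA_nil]
    | cons u J =>
      rw [pairing_bernsteinA_cons, ih]
      simp [ite_and]

/-! ### The bases of immaculate and dual immaculate functions -/

theorem repr_eq_pairing [DecidableEq A] (f : NSymA A) (K : Sentence A) :
    (hBasis A).repr f K = pairing f (M K) := by
  have : (hBasis A).coord K = pairing.flip (M K) := by
    refine (hBasis A).ext fun I => ?_
    rw [Module.Basis.coord_apply, Module.Basis.repr_self, LinearMap.flip_apply, hBasis_apply,
      pairing_H_M, Finsupp.single_apply]
  exact LinearMap.congr_fun this f

variable (A) in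
/-- The sentences with `n` letters. -/
abbrev SentenceOfSize (n : ℕ) := {K : Sentence A // (maxWord K).length = n}

/-- A sentence is a refinement of the one-word sentence with the same letters. -/
instance [Finite A] (n : ℕ) : Finite (SentenceOfSize A n) := by
  have h : ∀ w : Word A, {K : Sentence A | maxWord K = w}.Finite := by
    classical
    intro w
    refine (refinements (consWord w [])).toFinset.finite_toSet.subset fun K hK => ?_
    rw [List.coe_toFinset, Set.mem_ofPred_eq, mem_refinements, refines_iff]
    obtain rfl : maxWord K = w := hK
    refine ⟨by simp, ?_⟩
    by_cases hw : maxWord K = []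
    · rw [hw]
      simp [partialSums_nil]
    · rw [consWord_of_ne hw, wordLengths_cons, partialSums_cons]
      simp only [wordLengths_nil, partialSums_nil, Set.image_empty, insert_empty_eq,
        Set.singleton_subset_iff, coe_wordLength]
      refine ⟨(wordLengths K).length, Nat.one_le_iff_ne_zero.2 fun h => hw ?_, le_rfl, ?_⟩
      · rw [List.eq_nil_of_map_eq_nil (List.eq_nil_of_length_eq_zero h), maxWord_nil]
      · rw [List.take_length, sum_wordLengths]
  have := (List.finite_length_eq A n).biUnion fun w _ => h w
  exact Set.Finite.to_subtype (this.subset fun K hK => Set.mem_biUnion (x := maxWord K) hK rfl)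

theorem linearIndependent_dualImmaculateA :
    LinearIndependent ℚ (dualImmaculateA : Sentence A → ColSeries A) := by
  classical
  rw [linearIndependent_iff']
  intro s g hg I hI
  have := congrArg (pairing (immaculateA I)) hg
  simpa [pairing_immaculateA, hI] using this

theorem linearIndependent_immaculateA :
    LinearIndependent ℚ (immaculateA : Sentence A → NSymA A) := by
  classical
  rw [linearIndependent_iff']
  intro s g hg I hI
  have := congrArg (fun f => pairing f (dualImmaculateA I)) hg
  simpa [pairing_immaculateA, hI] using this

theorem dualImmaculateA_mem_span [Finite A] (J : Sentence A) : dualImmaculateA J ∈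
    Submodule.span ℚ (Set.range fun K : SentenceOfSize A (maxWord J).length => M K.1) := by
  classical
  have := Fintype.ofFinite (SentenceOfSize A (maxWord J).length)
  have h : dualImmaculateA J =
      ∑ K : SentenceOfSize A (maxWord J).length, (tabCount J K.1 : ℚ) • M K.1 := by
    funext m
    have hm : (∑ K : SentenceOfSize A (maxWord J).length, (tabCount J K.1 : ℚ) • M K.1) m =
        ∑ K : SentenceOfSize A (maxWord J).length, (tabCount J K.1 : ℚ) * M K.1 m := by
      exact map_sum (ColSeries.coeff m) _ _
    rw [hm, dualImmaculateA_apply]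
    simp only [M_apply]
    by_cases hsize : (maxWord (flat m)).length = (maxWord J).length
    · rw [Finset.sum_eq_single ⟨flat m, hsize⟩]
      · simp
      · intro K _ hK
        rw [if_neg fun h => hK (Subtype.ext h.symm), mul_zero]
      · simp
    · rw [tabCount_eq_zero fun h => hsize h.symm, Finset.sum_eq_zero, Nat.cast_zero]
      intro K _
      rw [if_neg fun h : flat m = K.1 => hsize (h ▸ K.2), mul_zero]
  rw [h]
  exact Submodule.sum_mem _ fun K _ => Submodule.smul_mem _ _ (Submodule.subset_span ⟨K, rfl⟩)

/-- In each degree there are as many dual immaculate functions as monomial functions, so that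
independence implies that they span. -/
theorem span_dualImmaculateA_ofSize [Finite A] (n : ℕ) :
    Submodule.span ℚ (Set.range fun J : SentenceOfSize A n => dualImmaculateA J.1) =
      Submodule.span ℚ (Set.range fun K : SentenceOfSize A n => M K.1) := by
  have := Fintype.ofFinite (SentenceOfSize A n)
  have := FiniteDimensional.span_of_finite ℚ
    (Set.finite_range fun K : SentenceOfSize A n => M K.1)
  refine Submodule.eq_of_le_of_finrank_le (Submodule.span_le.2 ?_) ?_
  · rintro _ ⟨⟨J, rfl⟩, rfl⟩
    exact dualImmaculateA_mem_span J
  · have h : LinearIndependent ℚ fun J : SentenceOfSize A n => dualImmaculateA J.1 :=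
      linearIndependent_dualImmaculateA.comp _ Subtype.val_injective
    rw [finrank_span_eq_card h]
    exact finrank_range_le_card _

theorem span_dualImmaculateA [Finite A] :
    Submodule.span ℚ (Set.range (dualImmaculateA (A := A))) = QSymA A := by
  refine le_antisymm (Submodule.span_le.2 ?_) (Submodule.span_le.2 ?_)
  · rintro _ ⟨J, rfl⟩
    refine Submodule.span_mono ?_ (dualImmaculateA_mem_span J)
    rintro _ ⟨K, rfl⟩
    exact ⟨K.1, rfl⟩
  · rintro _ ⟨K, rfl⟩
    have h : M K ∈ Submodule.span ℚ (Set.range fun J : SentenceOfSize A (maxWord K).length =>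
        dualImmaculateA J.1) := by
      rw [span_dualImmaculateA_ofSize]
      exact Submodule.subset_span ⟨⟨K, rfl⟩, rfl⟩
    refine Submodule.span_mono ?_ h
    rintro _ ⟨J, rfl⟩
    exact ⟨J.1, rfl⟩

/-- The pairing separates the elements of `NSym_A`. -/
theorem eq_zero_of_pairing_eq_zero [Finite A] {f : NSymA A}
    (h : ∀ J, pairing f (dualImmaculateA J) = 0) : f = 0 := by
  classical
  have h1 : QSymA A ≤ LinearMap.ker (pairing f) := by
    rw [← span_dualImmaculateA, Submodule.span_le]
    rintro _ ⟨J, rfl⟩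
    exact h J
  refine (hBasis A).repr.map_eq_zero_iff.1 (Finsupp.ext fun K => ?_)
  rw [repr_eq_pairing]
  exact h1 (Submodule.subset_span ⟨K, rfl⟩)

/-- The expansion `H_K = ∑_J ⟨H_K, 𝔖*_J⟩ 𝔖_J` holds since both sides have the same pairings with
all dual immaculate functions. -/
theorem span_immaculateA [Finite A] :
    ⊤ ≤ Submodule.span ℚ (Set.range (immaculateA (A := A))) := by
  classical
  rw [← (hBasis A).span_eq, Submodule.span_le]
  rintro _ ⟨K, rfl⟩
  have := Fintype.ofFinite (SentenceOfSize A (maxWord K).length)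
  have h : H K - ∑ J : SentenceOfSize A (maxWord K).length,
      (tabCount J.1 K : ℚ) • immaculateA J.1 = 0 := by
    refine eq_zero_of_pairing_eq_zero fun J => ?_
    simp only [map_sub, map_sum, map_smul, LinearMap.sub_apply, LinearMap.sum_apply,
      LinearMap.smul_apply, pairing_H_dualImmaculateA, pairing_immaculateA, smul_eq_mul]
    by_cases hsize : (maxWord J).length = (maxWord K).length
    · rw [Finset.sum_eq_single ⟨J, hsize⟩]
      · simp
      · intro I _ hI
        rw [if_neg fun h => hI (Subtype.ext h), mul_zero]
      · simp
    · rw [tabCount_eq_zero hsize, Finset.sum_eq_zero, Nat.cast_zero, sub_zero]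
      intro I _
      rw [if_neg fun h : I.1 = J => hsize (h ▸ I.2), mul_zero]
  rw [hBasis_apply, SetLike.mem_coe, sub_eq_zero.1 h]
  exact Submodule.sum_mem _ fun J _ => Submodule.smul_mem _ _ (Submodule.subset_span ⟨J.1, rfl⟩)

theorem exists_dual_bases [Finite A] [DecidableEq A] :
    ∃ (b : Module.Basis (Sentence A) ℚ (NSymA A)) (c : Module.Basis (Sentence A) ℚ (QSymA A)),
      (∀ J : Sentence A, b J = immaculateA J) ∧
      (∀ J : Sentence A, (c J : ColSeries A) = dualImmaculateA J) ∧
      (∀ I J : Sentence A, pairing (b I) (c J : ColSeries A) = if I = J then 1 else 0) := by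
  have hb : ∀ J : Sentence A,
      Module.Basis.mk linearIndependent_immaculateA span_immaculateA J = immaculateA J :=
    fun J => Module.Basis.mk_apply _ _ J
  have hc : ∀ J : Sentence A, (((Module.Basis.span (linearIndependent_dualImmaculateA (A := A))).map
      (LinearEquiv.ofEq _ _ span_dualImmaculateA) J : QSymA A) : ColSeries A) =
        dualImmaculateA J := by
    intro J
    rw [Module.Basis.map_apply, LinearEquiv.coe_ofEq_apply, Module.Basis.span_apply]
  exact ⟨_, _, hb, hc, fun I J => by rw [hb, hc, pairing_immaculateA]⟩

/-! ### Uncoloring -/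

theorem uncolor_H (I : Sentence A) : uncolor (H I) = Hcomp (wordLengths I) := by
  simp [uncolor, H, MonoidAlgebra.of_apply]

theorem Hcomp_nil : Hcomp [] = 1 := map_one (MonoidAlgebra.of ℚ (FreeMonoid ℕ+))

theorem Hint_mul_Hcomp (w : NWord A) (α : Comp) :
    Hint (w.1.length : ℤ) * Hcomp α = Hcomp (wordLength w :: α) := by
  have h : (0 : ℤ) < w.1.length := by exact_mod_cast List.length_pos_iff.2 w.2
  rw [Hint, dif_pos h, Hcomp, Hcomp, Hcomp, ← map_mul, ← FreeMonoid.ofList_append]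
  rfl

theorem wordLengths_eq_map (I : Sentence A) : wordLengths I = I.map wordLength := rfl

theorem length_wordLengths (I : Sentence A) : I.length = (wordLengths I).length :=
  (List.length_map _).symm

section OneLetter

variable [Unique A]

variable (A) in
/-- Words over a one-letter alphabet are determined by their lengths. -/
def lengthEquiv : FreeAddMonoid A ≃+ ℕ where
  toFun w := (FreeAddMonoid.toList w).length
  invFun n := FreeAddMonoid.ofList (List.replicate n default)
  left_inv w := FreeAddMonoid.toList.injective
    (List.eq_replicate_iff.2 ⟨rfl, fun _ _ => Unique.eq_default _⟩).symm
  right_inv n := List.length_replicate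
  map_add' v w := by simp

variable (A) in
/-- Sentences over a one-letter alphabet are determined by their word lengths. -/
def wordLengthsEquiv : Sentence A ≃ Comp :=
  Equiv.ofBijective wordLengths <| by
    constructor
    · refine List.map_injective_iff.2 fun v w h => Subtype.ext ?_
      exact (lengthEquiv A).injective (congrArg PNat.val h : v.1.length = w.1.length)
    · intro α
      induction α with
      | nil => exact ⟨[], rfl⟩
      | cons n α ih =>
        obtain ⟨I, rfl⟩ := ih
        refine ⟨⟨List.replicate n default, by simp⟩ :: I, ?_⟩
        rw [wordLengths_cons]
        congr 1
        exact PNat.eq (by simp)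

@[simp] theorem wordLengthsEquiv_apply (I : Sentence A) :
    wordLengthsEquiv A I = wordLengths I := rfl

variable (A) in
/-- The exponent of the commutative monomial obtained from a colored monomial by forgetting the
colors. -/
def exponentEquiv : ColMonomial A ≃+ (ℕ →₀ ℕ) where
  toFun m := m.mapRange (lengthEquiv A) (map_zero _)
  invFun m := m.mapRange (lengthEquiv A).symm (map_zero _)
  left_inv m := Finsupp.ext fun n => (lengthEquiv A).symm_apply_apply (m n)
  right_inv m := Finsupp.ext fun n => (lengthEquiv A).apply_symm_apply (m n)
  map_add' := Finsupp.mapRange_add (map_add _)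

theorem exponentEquiv_placeAt {k : ℕ} (w : Fin k → FreeAddMonoid A) (j : Fin k → ℕ) :
    exponentEquiv A (placeAt w j) = placeAt (fun i => lengthEquiv A (w i)) j := by
  rw [placeAt, placeAt, map_list_sum, List.map_ofFn]
  congr 2
  funext i
  exact Finsupp.mapRange_single (hf := map_zero (lengthEquiv A))

/-- The colored series of a commutative power series over a one-letter alphabet. -/
def colorSeries (F : MvPowerSeries ℕ ℚ) : ColSeries A := fun m => F (exponentEquiv A m)

theorem formalSum_placeAt_cast {W : Type*} [AddMonoid W] {n k : ℕ} (e : k = n) (w : Fin n → W)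
    (w' : Fin k → W) (h : ∀ i, w' i = w (Fin.cast e i)) :
    formalSum (fun j : Fin n ↪o ℕ => placeAt w j) =
      formalSum fun j : Fin k ↪o ℕ => placeAt w' j := by
  subst e
  obtain rfl : w' = w := funext h
  rfl

theorem placeAt_cast {W : Type*} [AddMonoid W] {n k : ℕ} (e : k = n) (w : Fin n → W)
    (w' : Fin k → W) (h : ∀ i, w' i = w (Fin.cast e i)) :
    placeAt w (fun i => (i : ℕ)) = placeAt w' fun i => (i : ℕ) := by
  subst e
  obtain rfl : w' = w := funext h
  rfl

theorem lengthEquiv_wordAt (I : Sentence A) (i : Fin I.length) : lengthEquiv A (wordAt I i) =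
    ((wordLengths I).get (Fin.cast (length_wordLengths I) i) : ℕ) := by
  have h : ∀ i : Fin (I.map wordLength).length,
      (I.map wordLength).get i = wordLength (I.get (Fin.cast (List.length_map _) i)) := by simp
  exact (congrArg PNat.val (h (Fin.cast (List.length_map _).symm i))).symm

theorem exponentEquiv_stdMonomial (I : Sentence A) :
    exponentEquiv A (stdMonomial I) = stdExponent (wordLengths I) := by
  rw [stdMonomial, exponentEquiv_placeAt, stdExponent]
  exact (placeAt_cast (length_wordLengths I) _ _ (lengthEquiv_wordAt I)).symm

theorem colorSeries_Mcomp (I : Sentence A) : colorSeries (Mcomp (wordLengths I)) = M I := by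
  funext m
  rw [colorSeries, Mcomp, formalSum_placeAt_cast (length_wordLengths I) _ _ (lengthEquiv_wordAt I),
    M, formalSum, formalSum]
  congr 2
  simp only [← exponentEquiv_placeAt, EmbeddingLike.apply_eq_iff_eq]

theorem colorSeries_mul (F G : MvPowerSeries ℕ ℚ) :
    (colorSeries (F * G) : ColSeries A) = colorSeries F * colorSeries G := by
  funext m
  let e : {p : ColMonomial A × ColMonomial A // p.1 + p.2 = m} ≃
      {p : (ℕ →₀ ℕ) × (ℕ →₀ ℕ) // p.1 + p.2 = exponentEquiv A m} :=
    ((exponentEquiv A).toEquiv.prodCongr (exponentEquiv A).toEquiv).subtypeEquiv fun p => by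
      simp [← map_add]
  have h1 : ∑ p ∈ Finset.HasAntidiagonal.antidiagonal (exponentEquiv A m), F p.1 * G p.2 =
      ∑ᶠ p : {p : (ℕ →₀ ℕ) × (ℕ →₀ ℕ) // p.1 + p.2 = exponentEquiv A m}, F p.1.1 * G p.1.2 := by
    rw [finsum_subtype_eq_finsum_cond (f := fun p : (ℕ →₀ ℕ) × (ℕ →₀ ℕ) => F p.1 * G p.2)
      (fun p : (ℕ →₀ ℕ) × (ℕ →₀ ℕ) => p.1 + p.2 = exponentEquiv A m)]
    simp only [← Finset.HasAntidiagonal.mem_antidiagonal]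
    rw [finsum_mem_finset_eq_sum]
  have h2 := finsum_comp_equiv e (f := fun p => F p.1.1 * G p.1.2)
  exact (MvPowerSeries.coeff_mul _ F G).trans (h1.trans h2.symm)

theorem pairingU_uncolor (f : NSymA A) (F : MvPowerSeries ℕ ℚ) :
    pairingU (uncolor f) F = pairing f (colorSeries F) := by
  have : pairingU.flip F ∘ₗ uncolor = pairing.flip (colorSeries F : ColSeries A) := by
    refine (hBasis A).ext fun K => ?_
    rw [hBasis_apply, LinearMap.comp_apply, LinearMap.flip_apply, LinearMap.flip_apply, uncolor_H,
      pairing_H, colorSeries, exponentEquiv_stdMonomial]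
    simp [pairingU, Hcomp, MonoidAlgebra.of_apply, MvPowerSeries.coeff_apply]
  exact LinearMap.congr_fun this f

/-- The commutativity of the uncolored product turns multiplication on the left, in the definition of
`perpU`, into multiplication on the right, in that of `rperp`. -/
theorem perpU_uncolor (S : Sentence A) (f : NSymA A) :
    perpU (Mcomp (wordLengths S)) (uncolor f) = uncolor (rperp (M S) f) := by
  classical
  have h : ∀ I : Sentence A, pairingU (uncolor f) (Mcomp (wordLengths S) * Mcomp (wordLengths I)) •
      Hcomp (wordLengths I) = uncolor (pairing f (M I * M S) • H I) := by
    intro I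
    rw [pairingU_uncolor, mul_comm, colorSeries_mul, colorSeries_Mcomp, colorSeries_Mcomp,
      map_smul, uncolor_H]
  rw [perpU, ← finsum_comp_equiv (wordLengthsEquiv A)]
  simp only [wordLengthsEquiv_apply, h]
  rw [rperp]
  refine (AddMonoidHom.map_finsum (uncolor (A := A)).toAddMonoidHom ?_).symm
  simp only [← repr_splitOp]
  exact (finsum_coeff_smul_H _).1

variable (A) in
/-- The sentence of `n` words of one letter. -/
def ones (n : ℕ) : Sentence A := List.replicate n ⟨[default], List.cons_ne_nil _ _⟩

theorem wordLengths_ones (n : ℕ) : wordLengths (ones A n) = List.replicate n 1 := by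
  rw [ones, wordLengths_eq_map, List.map_replicate]
  rfl

theorem forall_length_eq_one_iff (S : Sentence A) :
    (∀ w ∈ S, w.1.length = 1) ↔ S = ones A S.length := by
  constructor
  · intro h
    refine List.eq_replicate_iff.2 ⟨rfl, fun w hw => Subtype.ext ?_⟩
    exact (lengthEquiv A).injective (h w hw : w.1.length = 1)
  · intro h w hw
    rw [h, ones] at hw
    rw [List.eq_of_mem_replicate hw]
    rfl

theorem eq_ones_of_refines {Q : Sentence A} {n : ℕ} (h : Sentence.Refines Q (ones A n)) :
    Q = ones A n := by
  induction n generalizing Q with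
  | zero => exact (refines_nil_right Q).1 h
  | succ n ih =>
    cases Q with
    | nil => exact ((refines_nil_left _).1 h).symm
    | cons q Q =>
      obtain ⟨b, hb, hQ⟩ := (refines_cons_cons q _ Q (ones A n)).1 h
      have hq := List.length_pos_iff.2 q.2
      have hl := congrArg List.length hb
      simp only [List.length_cons, List.length_nil, List.length_append] at hl
      obtain rfl : b = [] := List.eq_nil_of_length_eq_zero (by omega)
      rw [ih hQ, Subtype.ext ((List.append_nil q.1).symm.trans hb.symm)]
      rfl

theorem refines_of_wordLengths {Q S : Sentence A}
    (h : Comp.Refines (wordLengths Q) (wordLengths S)) : Sentence.Refines Q S := by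
  refine ⟨(lengthEquiv A).injective ?_, h⟩
  have := h.1
  rwa [sum_wordLengths, sum_wordLengths] at this

/-- The composition `(1, …, 1)` has no proper refinement. -/
theorem Fcomp_replicate_one (n : ℕ) : Fcomp (List.replicate n 1) = Mcomp (List.replicate n 1) := by
  have h : ∀ β : Comp, Comp.Refines β (List.replicate n 1) ↔ β = List.replicate n 1 := by
    intro β
    constructor
    · intro h
      obtain ⟨Q, rfl⟩ := (wordLengthsEquiv Unit).surjective β
      rw [← wordLengths_ones (A := Unit)] at h ⊢
      rw [wordLengthsEquiv_apply] at h ⊢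
      rw [eq_ones_of_refines (refines_of_wordLengths h)]
    · rintro rfl
      exact ⟨rfl, subset_rfl⟩
  rw [Fcomp]
  simp only [h]
  exact finsum_cond_eq_left

/-- Over a one-letter alphabet all words `w(Q^r)`, for `Q` a refinement of `S`, agree, so that the
signs cancel unless all words of `S` have length one. -/
theorem uncolor_bernsteinA (v : NWord A) (f : NSymA A) :
    uncolor (bernsteinA v.1 f) = bernsteinU (v.1.length : ℤ) (uncolor f) := by
  classical
  rw [bernsteinA_eq, map_splitOp, bernsteinU]
  have h : ∀ i : ℕ, (-1 : ℚ) ^ i • (Hint ((v.1.length : ℤ) + i) *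
      perpU (Fcomp (List.replicate i 1)) (uncolor f)) = splitOp (fun I S =>
        if S = ones A i then (-1 : ℚ) ^ i • (Hint ((v.1.length : ℤ) + i) * Hcomp (wordLengths I))
        else 0) f := by
    intro i
    rw [Fcomp_replicate_one, ← wordLengths_ones (A := A), perpU_uncolor, rperp_M, map_splitOp]
    refine (map_splitOp ((-1 : ℚ) ^ i • LinearMap.mulLeft ℚ (Hint ((v.1.length : ℤ) + i)))
      _ f).trans ?_
    congr 2
    funext I S
    by_cases hS : S = ones A i <;> simp [hS, uncolor_H]
  simp only [h]
  refine (finsum_splitOp _ _ (fun I S => ?_) f).2.symm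
  have hs : ∀ i, i ≠ S.length → (if S = ones A i then (-1 : ℚ) ^ i •
      (Hint ((v.1.length : ℤ) + i) * Hcomp (wordLengths I)) else 0) = 0 := fun i hi =>
    if_neg fun hS => hi (by rw [hS, ones, List.length_replicate])
  refine ⟨(Set.finite_singleton S.length).subset fun i hi => ?_, ?_⟩
  · by_contra hn
    exact hi (hs i hn)
  · have hc : (altRefSum S fun Q => uncolor (H (consWord (v.1 ++ maxWord Q.reverse) I))) =
        altRefSum S fun _ =>
          Hint ((v.1.length : ℤ) + (maxWord S).length) * Hcomp (wordLengths I) := by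
      refine congrArg List.sum (List.map_congr_left fun Q hQ => ?_)
      have hQ' := ((refines_iff Q S).1 (mem_refinements.1 hQ)).1
      beta_reduce
      rw [consWord_of_ne (List.append_ne_nil_of_left_ne_nil v.2 _), uncolor_H, wordLengths_cons,
        ← Hint_mul_Hcomp, List.length_append, length_maxWord_reverse, hQ', Nat.cast_add]
    rw [finsum_eq_single _ S.length hs, map_altRefSum, hc]
    by_cases hS : ∀ w ∈ S, w.1.length = 1
    · have hl : (maxWord S).length = S.length := by
        rw [(forall_length_eq_one_iff S).1 hS]
        simp [maxWord, ones]
      rw [if_pos ((forall_length_eq_one_iff S).1 hS), altRefSum_const_of_forall_length hS, hl]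
    · rw [if_neg fun hn => hS ((forall_length_eq_one_iff S).2 hn)]
      push Not at hS
      obtain ⟨w, hw, hw1⟩ := hS
      exact (altRefSum_const_eq_zero hw hw1 _).symm

theorem uncolor_immaculateA (I : Sentence A) : uncolor (immaculateA I) =
    immaculateU ((wordLengths I).map fun n : ℕ+ => ((n : ℕ) : ℤ)) := by
  induction I with
  | nil =>
    change uncolor 1 = 1
    rw [← H_nil, uncolor_H, wordLengths_nil, Hcomp_nil]
  | cons v I ih =>
    rw [wordLengths_cons, List.map_cons]
    change uncolor (bernsteinA v.1 (immaculateA I)) = bernsteinU (v.1.length : ℤ) (immaculateU _)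
    rw [uncolor_bernsteinA, ih]

end OneLetter

end ColoredImmaculate

end

theorem mainTheorem7 (A : Type*) [Finite A] [DecidableEq A] :
    (∃ (b : Module.Basis (Sentence A) ℚ (NSymA A)) (c : Module.Basis (Sentence A) ℚ (QSymA A)),
      (∀ J : Sentence A, b J = immaculateA J) ∧
      (∀ J : Sentence A, (c J : ColSeries A) = dualImmaculateA J) ∧
      (∀ I J : Sentence A, pairing (b I) (c J : ColSeries A) = if I = J then 1 else 0)) ∧
    (Nat.card A = 1 → ∀ I : Sentence A,
      uncolor (immaculateA I) = immaculateU ((wordLengths I).map fun n : ℕ+ => ((n : ℕ) : ℤ))) := by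
  refine ⟨exists_dual_bases, fun h I => ?_⟩
  obtain ⟨h1, ⟨a⟩⟩ := Nat.card_eq_one_iff_unique.1 h
  have : Unique A := ⟨⟨a⟩, fun b => Subsingleton.elim _ _⟩
  exact uncolor_immaculateA I
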